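/- Let $P$ be a countable right Ore monoid: for all $x_1,x_2\in P$ there are $y_1,y_2\in P$ with $x_1y_1=x_2y_2$, and $xy_1=xy_2$ implies $y_1z=y_2z$ for some $z\in P$. Let $G=\{pq^{-1}\mid p,q\in P\}$ be its group completion; here $p_1q_1^{-1}=p_2q_2^{-1}$ if and only if $p_1t_1=p_2t_2$ and $q_1t_1=q_2t_2$ for some $t_1,t_2\in P$. Let $X$ be a second countable, locally compact Hausdorff space with an action of $P$ by proper topological correspondences. That is, for each $p\in P$ there are a locally compact Hausdorff space $M_p$, a proper continuous map $r_p\colon M_p\to X$ and a local homeomorphism $s_p\colon M_p\to X$, with $M_1=X$ and $r_1=s_1=\mathrm{id}_X$; and for all $p,q\in P$ there are homeomorphisms $\sigma_{p,q}=(r_{p,q},s_{p,q})\colon M_{pq}\to M_p\times_{s_p,X,r_q}M_q$, which are the canonical ones if $p=1$ or $q=1$ and which satisfy the associativity conditions $r_{p,q}\circ r_{pq,t}=r_{p,qt}$, $s_{p,q}\circ r_{pq,t}=r_{q,t}\circ s_{p,qt}$ and $s_{pq,t}=s_{q,t}\circ s_{p,qt}$ for all $p,q,t\in P$. Let $H^0=\{(m_p)_{p\in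 P}\in\prod_{p} M_p\mid r_{p,q}(m_{pq})=m_p \text{ for all } p,q\in P\}$ with the subspace topology, let $\pi_1\colon H^0\to M_1=X$ be the projection $(m_p)_p\mapsto m_1$, and let $\tilde s_t\colon H^0\to H^0$, $(m_p)_p\mapsto (s_{t,p}(m_{tp}))_p$, for $t\in P$. Let $H$ be the étale groupoid with object space $H^0$ and arrow space $$H^1=\{(x,g,y)\in H^0\times G\times H^0\mid \exists\, p_1,p_2\in P:\ g=p_1p_2^{-1},\ \tilde s_{p_1}(x)=\tilde s_{p_2}(y)\},$$ with range $r(x,g,y)=x$ and source $s(x,g,y)=y$; its topology is the quotient topology from the disjoint union over $p_1,p_2\in P$ of the spaces $\{(x,y)\mid \tilde s_{p_1}(x)=\tilde s_{p_2}(y)\}\subseteq H^0\times H^0$ under $(x,y)\mapsto(x,p_1p_2^{-1},y)$. Put $H^1_g=\{(x,g,y)\in H^1\}$ for $g\in G$. A bisection is an open subset of $H^1$ on which $r$ and $s$ are injective. Let $c\colon P\to(0,\infty)$ be a homomorphism to the multiplicative group of positive reals, extended to $G$ by $c(pq^{-1})=c(p)/c(q)$. "Measure" means (positive) Radon measure.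 A measure $\mu$ on $H^0$ is called $c$-invariant if $\mu(r(B))=c(g)\,\mu(s(B))$ for all $g\in G$ and all bisections $B\subseteq H^1_g$. A measure $\lambda$ on $X$ is called $c$-invariant if $\lambda=c(p)\,(r_p)_*s_p^*\lambda$ for all $p\in P$; here $(r_p)_*$ is the push-forward of measures and $s_p^*\lambda$ is the measure $B\mapsto\int_X|s_p^{-1}(x)\cap B|\,d\lambda(x)$ on the Borel subsets of $M_p$. **Theorem.** The map $\mu\mapsto(\pi_1)_*\mu$ is a bijection from the set of $c$-invariant measures on $H^0$ onto the set of $c$-invariant measures on $X$. -/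

import Mathlib

open Set MeasureTheory TopologicalSpace

universe u v w

noncomputable section

/-! ### Right Ore monoids and their groups of fractions -/

/-- A right Ore monoid. -/
class RightOreMonoid (P : Type w) [Monoid P] : Prop where
  exists_mul_eq : ∀ x₁ x₂ : P, ∃ y₁ y₂ : P, x₁ * y₁ = x₂ * y₂
  exists_mul_eq_of_mul_eq : ∀ x y₁ y₂ : P, x * y₁ = x * y₂ → ∃ z : P, y₁ * z = y₂ * z

/-- Two formal quotients `p₁ q₁⁻¹` and `p₂ q₂⁻¹` are equivalent if
`(p₁ t₁, q₁ t₁) = (p₂ t₂, q₂ t₂)` for some `t₁, t₂`. -/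
def fracSetoid (P : Type w) [Monoid P] [RightOreMonoid P] : Setoid (P × P) where
  r a b := ∃ t₁ t₂ : P, a.1 * t₁ = b.1 * t₂ ∧ a.2 * t₁ = b.2 * t₂
  iseqv :=
    { refl := fun _ => ⟨1, 1, rfl, rfl⟩
      symm := fun ⟨t₁, t₂, h₁, h₂⟩ => ⟨t₂, t₁, h₁.symm, h₂.symm⟩
      trans := by
        rintro a b d ⟨t₁, t₂, h₁, h₂⟩ ⟨u₁, u₂, k₁, k₂⟩
        obtain ⟨y, z, hyz⟩ := RightOreMonoid.exists_mul_eq t₂ u₁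
        refine ⟨t₁ * y, u₂ * z, ?_, ?_⟩
        · rw [← mul_assoc, h₁, mul_assoc, hyz, ← mul_assoc, k₁, mul_assoc]
        · rw [← mul_assoc, h₂, mul_assoc, hyz, ← mul_assoc, k₂, mul_assoc] }

/-- The underlying set of the group completion `G` of a right Ore monoid `P`: classes of formal
quotients `p q⁻¹`. -/
def FracGroup (P : Type w) [Monoid P] [RightOreMonoid P] : Type w := Quotient (fracSetoid P)

/-- The element `p q⁻¹` of `G`. -/
def FracGroup.mk {P : Type w} [Monoid P] [RightOreMonoid P] (p q : P) : FracGroup P :=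
  Quotient.mk (fracSetoid P) (p, q)

/-- The extension of a homomorphism `c : P → (0,∞)` to `G`, `c (p q⁻¹) = c p / c q`. -/
def FracGroup.extend {P : Type w} [Monoid P] [RightOreMonoid P]
    (c : P →* {x : ℝ // 0 < x}) : FracGroup P → {x : ℝ // 0 < x} :=
  Quotient.lift (fun a : P × P => c a.1 / c a.2) (by
    rintro a b ⟨t₁, t₂, h₁, h₂⟩
    have e₁ : c a.1 * c t₁ = c b.1 * c t₂ := by rw [← map_mul, h₁, map_mul]
    have e₂ : c a.2 * c t₁ = c b.2 * c t₂ := by rw [← map_mul, h₂, map_mul]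
    calc c a.1 / c a.2 = (c a.1 * c t₁) / (c a.2 * c t₁) := (mul_div_mul_right_eq_div _ _ _).symm
      _ = (c b.1 * c t₂) / (c b.2 * c t₂) := by rw [e₁, e₂]
      _ = c b.1 / c b.2 := mul_div_mul_right_eq_div _ _ _)

/-! ### Actions by proper topological correspondences -/

/-- An action of the monoid `P` on the space `X` by proper topological correspondences
`X ← M p → X`, with `r p` proper and `s p` a local homeomorphism, and with homeomorphisms
`M (p q) ≃ M p ×_{s, X, r} M q`. The latter are indexed by the equations `p * q = t`, so that
the unit and associativity conditions need no transport along equalities in `P`.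

The identification of `M 1` with `X` is given by the homeomorphism `r 1 = s 1`. The missing
components of the two unit conditions (`s p` and `r q`) follow from the fibre product
condition. -/
structure ProperCorrAction (P : Type w) [Monoid P] (X : Type u) [TopologicalSpace X]
    (M : P → Type v) [∀ p, TopologicalSpace (M p)] where
  r : ∀ p, M p → X
  s : ∀ p, M p → X
  isProperMap_r : ∀ p, IsProperMap (r p)
  isLocalHomeomorph_s : ∀ p, IsLocalHomeomorph (s p)
  σ : ∀ {p q t : P}, p * q = t → M t ≃ₜ {x : M p × M q // s p x.1 = r q x.2}
  s_one : s 1 = r 1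
  isHomeomorph_one : IsHomeomorph (r 1)
  σ_mul_one : ∀ (p : P) (m : M p), (σ (mul_one p) m).1.1 = m
  σ_one_mul : ∀ (q : P) (m : M q), (σ (one_mul q) m).1.2 = m
  /-- Cutting a story of length `p q t` into three pieces gives the same result both ways. -/
  assoc : ∀ {p q t a b d : P} (hpq : p * q = a) (hat : a * t = d) (hqt : q * t = b)
    (hpb : p * b = d) (m : M d),
    (σ hpq (σ hat m).1.1).1.1 = (σ hpb m).1.1 ∧
    (σ hpq (σ hat m).1.1).1.2 = (σ hqt (σ hpb m).1.2).1.1 ∧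
    (σ hat m).1.2 = (σ hqt (σ hpb m).1.2).1.2

namespace ProperCorrAction

variable {P : Type w} [Monoid P] {X : Type u} [TopologicalSpace X]
  {M : P → Type v} [∀ p, TopologicalSpace (M p)] (A : ProperCorrAction P X M)

/-- The map `r_{p,q} : M (p q) → M p`. -/
def rr {p q t : P} (h : p * q = t) (m : M t) : M p := (A.σ h m).1.1

/-- The map `s_{p,q} : M (p q) → M q`. -/
def ss {p q t : P} (h : p * q = t) (m : M t) : M q := (A.σ h m).1.2

/-- The space `H⁰` of complete histories: the limit of the spaces `M p` along the maps
`r_{p,q}`, with the subspace topology from the product. -/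
def H0 : Type (max v w) :=
  {m : ∀ p, M p // ∀ p q : P, A.rr (rfl : p * q = p * q) (m (p * q)) = m p}

instance : TopologicalSpace A.H0 := inferInstanceAs (TopologicalSpace (Subtype _))

instance : MeasurableSpace A.H0 := borel A.H0

instance : BorelSpace A.H0 := ⟨rfl⟩

/-- The projection `π₁ : H⁰ → M 1 ≅ X`. -/
def π₁ (m : A.H0) : X := A.r 1 (m.1 1)

/-- The map `s̃_t : H⁰ → H⁰`, `(m_p)_p ↦ (s_{t,p} (m_{t p}))_p`, forgetting the last time
period of length `t`. -/
def shift (t : P) (m : A.H0) : A.H0 :=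
  ⟨fun p => A.ss (rfl : t * p = t * p) (m.1 (t * p)), fun p q => by
    have key : ∀ {a : P} (h : t * p * q = a), A.rr h (m.1 a) = m.1 (t * p) := by
      rintro a rfl
      exact m.2 _ _
    have h := (A.assoc (rfl : t * p = t * p) (mul_assoc t p q) (rfl : p * q = p * q) rfl
      (m.1 (t * (p * q)))).2.1
    have k : (A.σ (mul_assoc t p q) (m.1 (t * (p * q)))).1.1 = m.1 (t * p) := key _
    rw [k] at h
    exact h.symm⟩

variable [RightOreMonoid P]

/-- The arrow space `H¹` of the transformation groupoid `H = Pᵒᵖ ⋉ H⁰`: triples `(x, g, y)`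
such that `g = p₁ p₂⁻¹` and `s̃_{p₁} x = s̃_{p₂} y` for some `p₁, p₂`. -/
def H1 : Type (max v w) :=
  {a : A.H0 × FracGroup P × A.H0 // ∃ p₁ p₂ : P, a.2.1 = FracGroup.mk p₁ p₂ ∧
    A.shift p₁ a.1 = A.shift p₂ a.2.2}

/-- The range map `r (x, g, y) = x`. -/
def range (a : A.H1) : A.H0 := a.1.1

/-- The degree `g` of `(x, g, y)`; the fibre over `g` is `H¹_g`. -/
def degree (a : A.H1) : FracGroup P := a.1.2.1

/-- The source map `s (x, g, y) = y`. -/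
def source (a : A.H1) : A.H0 := a.1.2.2

/-- The fibre product `H¹_{p₁,p₂}`, with the subspace topology from `H⁰ × H⁰`. -/
abbrev H1Piece (p₁ p₂ : P) : Type (max v w) :=
  {z : A.H0 × A.H0 // A.shift p₁ z.1 = A.shift p₂ z.2}

/-- The canonical surjection from the disjoint union of the `H¹_{p₁,p₂}` onto `H¹`. -/
def fromPieces (z : Σ i : P × P, A.H1Piece i.1 i.2) : A.H1 :=
  ⟨(z.2.1.1, FracGroup.mk z.1.1 z.1.2, z.2.1.2), z.1.1, z.1.2, rfl, z.2.2⟩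

/-- `H¹` carries the quotient topology from the disjoint union of the `H¹_{p₁,p₂}`. -/
instance : TopologicalSpace A.H1 := TopologicalSpace.coinduced A.fromPieces inferInstance

/-- A bisection of the étale groupoid `H`: an open set of arrows on which range and source
are injective. -/
def IsBisection (B : Set A.H1) : Prop :=
  IsOpen B ∧ InjOn A.range B ∧ InjOn A.source B

/-- `c`-invariance of a measure on `H⁰`: `μ (r(B)) = c(g) μ (s(B))` for each bisection
`B ⊆ H¹_g`. -/
def IsInvariantH0 (c : P →* {x : ℝ // 0 < x}) (μ : Measure A.H0) : Prop :=
  ∀ (g : FracGroup P) (B : Set A.H1), A.IsBisection B → (∀ b ∈ B, A.degree b = g) →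
    μ (A.range '' B) = ENNReal.ofReal (FracGroup.extend c g : ℝ) * μ (A.source '' B)

end ProperCorrAction

/-! ### Pull-back of measures along local homeomorphisms -/

section pullback

variable {M : Type v} {X : Type u}

/-- The pull-back `f^* ν` of a measure along a local homeomorphism: the integral against `ν` of
the counting measures on the fibres of `f`. The lemma `pullback_apply` below computes it. -/
def pullback [MeasurableSpace M] [MeasurableSpace X] (f : M → X) (ν : Measure X) : Measure M :=
  ν.bind fun y => Measure.count.restrict (f ⁻¹' {y})

theorem measurable_count_fibre [TopologicalSpace M] [TopologicalSpace X] [T2Space M] [T2Space X]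
    [SecondCountableTopology M] [MeasurableSpace M] [BorelSpace M] [MeasurableSpace X]
    [BorelSpace X] {f : M → X} (hf : IsLocalHomeomorph f) :
    Measurable fun y : X => (Measure.count : Measure M).restrict (f ⁻¹' {y}) := by
  refine Measure.measurable_of_measurable_coe _ fun B hB => ?_
  rcases isEmpty_or_nonempty M with hM | hM
  · have : B = ∅ := Set.eq_empty_of_isEmpty B
    simp [this]
  choose U hU hUf using isLocalHomeomorph_iff_isOpenEmbedding_restrict.1 hf
  obtain ⟨S, hSc, hS⟩ := countable_cover_nhds (f := fun x => interior (U x))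
    (fun x => interior_mem_nhds.2 (hU x))
  have hSne : S.Nonempty := by
    by_contra h
    rw [Set.not_nonempty_iff_eq_empty] at h
    subst h
    simp only [mem_empty_iff_false, iUnion_of_empty, iUnion_empty] at hS
    have h : hM.some ∈ (∅ : Set M) := hS ▸ mem_univ hM.some
    exact h
  obtain ⟨e, he⟩ := hSc.exists_eq_range hSne
  set V : ℕ → Set M := fun n => interior (U (e n)) with hV
  have hVu : ⋃ n, V n = univ := by
    rw [← hS, he, biUnion_range]
  set D := disjointed V with hD
  have hDm : ∀ n, MeasurableSet (D n) :=
    fun n => MeasurableSet.disjointed (fun k => isOpen_interior.measurableSet) n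
  have hDu : ⋃ n, D n = univ := by rw [hD, iUnion_disjointed, hVu]
  have hinj : ∀ n, InjOn f (V n) := fun n =>
    (injOn_iff_injective.2 (hUf (e n)).injective).mono interior_subset
  have hDV : ∀ n, D n ⊆ V n := fun n => disjointed_subset V n
  have himg : ∀ n, MeasurableSet (f '' (B ∩ D n)) := by
    intro n
    have hemb : Topology.IsOpenEmbedding ((V n).domRestrict f) :=
      (hf.comp isOpen_interior.isOpenEmbedding_subtypeVal.isLocalHomeomorph)
        |>.isOpenEmbedding_of_injective (injOn_iff_injective.1 (hinj n))
    have h1 : f '' (B ∩ D n) = (V n).domRestrict f '' (Subtype.val ⁻¹' (B ∩ D n)) := by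
      rw [Set.domRestrict_eq, Set.image_comp, Subtype.image_preimage_coe,
        Set.inter_eq_right.2 (inter_subset_right.trans (hDV n))]
    rw [h1]
    exact hemb.measurableEmbedding.measurableSet_image.2
      (measurable_subtype_coe (hB.inter (hDm n)))
  have key : ∀ y, (Measure.count : Measure M).restrict (f ⁻¹' {y}) B
      = ∑' n, (f '' (B ∩ D n)).indicator 1 y := by
    intro y
    have hy : MeasurableSet (f ⁻¹' {y}) :=
      (isClosed_singleton.preimage hf.continuous).measurableSet
    rw [Measure.restrict_apply hB]
    have h2 : B ∩ f ⁻¹' {y} = ⋃ n, (B ∩ D n ∩ f ⁻¹' {y}) := by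
      rw [← iUnion_inter, ← inter_iUnion, hDu, inter_univ]
    rw [h2, measure_iUnion (fun i j hij => ((disjoint_disjointed V hij).mono
      (inter_subset_left.trans inter_subset_right) (inter_subset_left.trans inter_subset_right)))
      (fun n => (hB.inter (hDm n)).inter hy)]
    refine tsum_congr fun n => ?_
    by_cases hmem : y ∈ f '' (B ∩ D n)
    · rw [indicator_of_mem hmem]
      obtain ⟨x, hx, rfl⟩ := hmem
      have : B ∩ D n ∩ f ⁻¹' {f x} = {x} := by
        ext z
        constructor
        · rintro ⟨hz, hzx⟩
          exact hinj n (hDV n hz.2) (hDV n hx.2) hzx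
        · rintro rfl
          exact ⟨hx, rfl⟩
      rw [this]
      simp
    · rw [indicator_of_notMem hmem]
      have : B ∩ D n ∩ f ⁻¹' {y} = ∅ := by
        ext z
        simp only [mem_inter_iff, mem_preimage, mem_singleton_iff, mem_empty_iff_false, iff_false]
        rintro ⟨hz, rfl⟩
        exact hmem ⟨z, hz, rfl⟩
      rw [this]
      simp
  simp_rw [key]
  exact Measurable.tsum fun n => measurable_one.indicator (himg n)

/-- `f^* ν (B) = ∫ |f⁻¹(y) ∩ B| dν(y)`. -/
theorem pullback_apply [TopologicalSpace M] [TopologicalSpace X] [T2Space M] [T2Space X]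
    [SecondCountableTopology M] [MeasurableSpace M] [BorelSpace M] [MeasurableSpace X]
    [BorelSpace X] {f : M → X} (hf : IsLocalHomeomorph f) (ν : Measure X) {B : Set M}
    (hB : MeasurableSet B) :
    pullback f ν B = ∫⁻ y, ((f ⁻¹' {y} ∩ B).encard : ENNReal) ∂ν := by
  rw [pullback, Measure.bind_apply hB (measurable_count_fibre hf).aemeasurable]
  refine lintegral_congr fun y => ?_
  have hy : MeasurableSet (f ⁻¹' {y}) :=
    (isClosed_singleton.preimage hf.continuous).measurableSet
  rw [Measure.restrict_apply hB, Set.inter_comm, Measure.count_apply (hy.inter hB)]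

end pullback

namespace ProperCorrAction

variable {P : Type w} [Monoid P] {X : Type u} [TopologicalSpace X]
  {M : P → Type v} [∀ p, TopologicalSpace (M p)]

/-- If `X` is second countable, then so are the spaces `M p`; so `pullback_apply` applies. -/
theorem secondCountable_M (A : ProperCorrAction P X M) [T2Space X] [LocallyCompactSpace X]
    [SecondCountableTopology X] (p : P) : SecondCountableTopology (M p) := by
  have : SigmaCompactSpace (M p) := by
    refine ⟨⟨fun n => A.r p ⁻¹' compactCovering X n,
      fun n => (A.isProperMap_r p).isCompact_preimage (isCompact_compactCovering X n), ?_⟩⟩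
    rw [← preimage_iUnion, iUnion_compactCovering, preimage_univ]
  choose U hU hUf using
    isLocalHomeomorph_iff_isOpenEmbedding_restrict.1 (A.isLocalHomeomorph_s p)
  obtain ⟨S, hSc, hS⟩ := countable_cover_nhds_of_sigmaCompact (f := fun x => interior (U x))
    (fun x => interior_mem_nhds.2 (hU x))
  have : Countable S := hSc.to_subtype
  have : ∀ x : S, SecondCountableTopology (interior (U x.1) : Set (M p)) := fun x => by
    have h1 : SecondCountableTopology (U x.1) :=
      (hUf x.1).isEmbedding.secondCountableTopology
    exact (Topology.IsEmbedding.inclusion interior_subset).secondCountableTopology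
  refine secondCountableTopology_of_countable_cover (U := fun x : S => interior (U x.1))
    (fun x => isOpen_interior) ?_
  rw [← hS, biUnion_eq_iUnion]

/-- `c`-invariance of a measure on `X`: `ν = c(p) (r_p)_* s_p^* ν` for all `p`. -/
def IsInvariantX [MeasurableSpace X] [∀ p, MeasurableSpace (M p)] (A : ProperCorrAction P X M)
    (c : P →* {x : ℝ // 0 < x}) (ν : Measure X) : Prop :=
  ∀ p : P, ν = ENNReal.ofReal (c p : ℝ) • (pullback (A.s p) ν).map (A.r p)

end ProperCorrAction

end

/-!
A Radon measure on the projective limit `H⁰` satisfies `μ K = inf_p (π_p)_* μ (π_p K)` for compact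
`K`, because the saturations `π_p⁻¹ (π_p K)` shrink to `K`. So it is determined by its images on the
spaces `M p`. Conversely, for a consistent family of Radon measures on the `M p` this formula
defines a regular content on `H⁰`, and hence a limit measure.

Invariance under bisections amounts to `μ = c(p) s̃_p^* μ` for all `p`. As `m ↦ (m_p, s̃_p m)`
identifies `H⁰` with the fibre product of `s_p` and `π₁`, base change turns this into
`(π_p)_* μ = c(p) s_p^* λ` for `λ = (π₁)_* μ`. This determines `μ` by `λ`. If `λ` is invariant then
the measures `c(p) s_p^* λ` are consistent under the maps `r_{p,q}`, again by base change. Each of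
them is concentrated on the image of `H⁰`: since the Ore conditions make the index category
filtered, a compact set that meets all images of the maps `r_{p,q}` contains some `π_p m`.
-/

noncomputable section

section LocalHomeomorph

open Topology

theorem isOpenMap_pullback_snd {M X Y : Type*} [TopologicalSpace M] [TopologicalSpace X]
    [TopologicalSpace Y] {f : M → X} (hf : IsOpenMap f) {g : Y → X} (hg : Continuous g) :
    IsOpenMap fun x : {x : M × Y // f x.1 = g x.2} => x.1.2 := by
  intro W hW
  rw [isOpen_iff_mem_nhds]
  rintro _ ⟨⟨⟨m, y⟩, hmy⟩, hxW, rfl⟩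
  obtain ⟨W', hW', rfl⟩ := isOpen_induced_iff.1 hW
  obtain ⟨U, V, hU, hV, hmU, hyV, hUV⟩ := isOpen_prod_iff.1 hW' m y hxW
  filter_upwards [hV.mem_nhds hyV, ((hf U hU).preimage hg).mem_nhds ⟨m, hmU, hmy⟩]
  rintro y' hy' ⟨m', hm', h⟩
  exact ⟨⟨(m', y'), h⟩, hUV ⟨hm', hy'⟩, rfl⟩

theorem isLocalHomeomorph_pullback_snd {M X Y : Type*} [TopologicalSpace M] [TopologicalSpace X]
    [TopologicalSpace Y] {f : M → X} (hf : IsLocalHomeomorph f) {g : Y → X} (hg : Continuous g) :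
    IsLocalHomeomorph fun x : {x : M × Y // f x.1 = g x.2} => x.1.2 := by
  rw [isLocalHomeomorph_iff_isOpenEmbedding_restrict]
  rintro ⟨⟨m, y⟩, hmy⟩
  obtain ⟨U, hU, hmU, hinj⟩ := hf.isLocallyInjective m
  have hU' : IsOpen {x : {x : M × Y // f x.1 = g x.2} | x.1.1 ∈ U} :=
    hU.preimage (continuous_fst.comp continuous_subtype_val)
  refine ⟨_, hU'.mem_nhds hmU, .of_continuous_injective_isOpenMap
    ((continuous_snd.comp continuous_subtype_val).comp continuous_subtype_val) ?_
    ((isOpenMap_pullback_snd hf.isOpenMap hg).domRestrict hU')⟩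
  rintro ⟨⟨⟨m₁, y₁⟩, h₁⟩, hm₁⟩ ⟨⟨⟨m₂, y₂⟩, h₂⟩, hm₂⟩ (rfl : y₁ = y₂)
  obtain rfl : m₁ = m₂ := hinj hm₁ hm₂ (h₁.trans h₂.symm)
  rfl

theorem isTopologicalBasis_isOpen_injOn {M X : Type*} [TopologicalSpace M] {f : M → X}
    (hf : IsLocallyInjective f) : IsTopologicalBasis {U : Set M | IsOpen U ∧ InjOn f U} := by
  refine isTopologicalBasis_of_isOpen_of_nhds (fun U hU => hU.1) fun x W hx hW => ?_
  obtain ⟨U, hU, hxU, hinj⟩ := hf x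
  exact ⟨U ∩ W, ⟨hU.inter hW, hinj.mono inter_subset_left⟩, ⟨hxU, hx⟩, inter_subset_right⟩

theorem bijOn_fst_fibre {T A B X : Type*} {f : A → X} {g : B → X}
    (e : T ≃ {x : A × B // f x.1 = g x.2}) (y : B) :
    BijOn (fun t => (e t).1.1) ((fun t => (e t).1.2) ⁻¹' {y}) (f ⁻¹' {g y}) := by
  refine ⟨?_, ?_, fun a ha => ⟨e.symm ⟨(a, y), ha⟩, ?_, ?_⟩⟩
  · rintro t rfl
    exact (e t).2
  · rintro t rfl t' ht' h
    exact e.injective (Subtype.ext (Prod.ext h ht'.symm))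
  all_goals simp only [mem_preimage, Equiv.apply_symm_apply, mem_singleton_iff]

end LocalHomeomorph

section Measure

theorem measure_ext_of_isTopologicalBasis {Y : Type*} [TopologicalSpace Y]
    [SecondCountableTopology Y] [MeasurableSpace Y] [BorelSpace Y] {μ ν : Measure Y}
    [IsLocallyFiniteMeasure μ] {S : Set (Set Y)} (hS : IsTopologicalBasis S) (hpi : IsPiSystem S)
    (h : ∀ U ∈ S, μ U = ν U) : μ = ν := by
  obtain ⟨T, hTc, hTS, hT⟩ := isOpen_sUnion_countable {U ∈ S | μ U < ⊤} fun U hU => hS.isOpen hU.1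
  refine Measure.ext_of_generateFrom_of_cover_subset
    (hS.borel_eq_generateFrom ▸ BorelSpace.measurable_eq) hpi (fun U hU => (hTS hU).1) hTc
    (hT.trans (sUnion_eq_univ_iff.2 fun y => ?_)) (fun U hU => (hTS hU).2.ne) h
  obtain ⟨V, hyV, hV, hlt⟩ := μ.exists_isOpen_measure_lt_top y
  obtain ⟨U, hU, hyU, hUV⟩ := hS.exists_subset_of_mem_open hyV hV
  exact ⟨U, ⟨hU, (measure_mono hUV).trans_lt hlt⟩, hyU⟩

theorem measure_ext_of_isCompact {Y : Type*} [TopologicalSpace Y] [MeasurableSpace Y]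
    {μ ν : Measure Y} [μ.Regular] [ν.Regular] (h : ∀ K, IsCompact K → μ K = ν K) : μ = ν := by
  refine Measure.OuterRegular.ext_isOpen fun U hU => ?_
  rw [hU.measure_eq_iSup_isCompact, hU.measure_eq_iSup_isCompact]
  exact iSup_congr fun K => iSup_congr fun _ => iSup_congr fun hK => h K hK

theorem isLocallyFiniteMeasure_ofReal_smul {Y : Type*} [TopologicalSpace Y] [MeasurableSpace Y]
    (a : ℝ) (μ : Measure Y) [IsLocallyFiniteMeasure μ] :
    IsLocallyFiniteMeasure (ENNReal.ofReal a • μ) :=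
  inferInstanceAs (IsLocallyFiniteMeasure (a.toNNReal • μ))

theorem regular_map_of_isProperMap {Y Z : Type*} [TopologicalSpace Y] [TopologicalSpace Z]
    [MeasurableSpace Y] [BorelSpace Y] [MeasurableSpace Z] [BorelSpace Z] [T2Space Z] {f : Y → Z}
    (hf : IsProperMap f) (μ : Measure Y) [μ.Regular] : (μ.map f).Regular where
  lt_top_of_isCompact K hK := by
    rw [Measure.map_apply hf.continuous.measurable hK.measurableSet]
    exact (hf.isCompact_preimage hK).measure_lt_top
  outerRegular A hA a ha := by
    rw [Measure.map_apply hf.continuous.measurable hA] at ha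
    obtain ⟨V, hAV, hV, hVa⟩ := (f ⁻¹' A).exists_isOpen_lt_of_lt a ha
    have hU : IsOpen (kernImage f V) := isClosedMap_iff_kernImage.1 hf.isClosedMap hV
    refine ⟨_, subset_kernImage_iff.2 hAV, hU, ?_⟩
    rw [Measure.map_apply hf.continuous.measurable hU.measurableSet]
    exact (measure_mono (subset_kernImage_iff.1 Subset.rfl)).trans_lt hVa
  innerRegular U hU a ha := by
    rw [Measure.map_apply hf.continuous.measurable hU.measurableSet] at ha
    obtain ⟨K, hKU, hK, hKa⟩ := (hU.preimage hf.continuous).exists_lt_isCompact ha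
    have hfK : IsCompact (f '' K) := hK.image hf.continuous
    refine ⟨_, image_subset_iff.2 hKU, hfK, ?_⟩
    rw [Measure.map_apply hf.continuous.measurable hfK.measurableSet]
    exact hKa.trans_le (measure_mono (subset_preimage_image f K))

theorem weaklyLocallyCompactSpace_of_isProperMap {Y Z : Type*} [TopologicalSpace Y]
    [TopologicalSpace Z] [WeaklyLocallyCompactSpace Z] {f : Y → Z} (hf : IsProperMap f) :
    WeaklyLocallyCompactSpace Y := by
  refine ⟨fun y => ?_⟩
  obtain ⟨K, hK, hyK⟩ := exists_compact_mem_nhds (f y)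
  exact ⟨_, hf.isCompact_preimage hK, hf.continuous.continuousAt hyK⟩

theorem image_disjointed {α β : Type*} {f : α → β} {N : ℕ → Set α} (hf : InjOn f (⋃ n, N n))
    (n : ℕ) : f '' disjointed N n = disjointed (fun n => f '' N n) n := by
  simp only [disjointed_apply, Finset.sup_set_eq_biUnion, ← image_iUnion₂]
  have hinj : InjOn f (N n ∪ ⋃ k ∈ Finset.Iio n, N k) :=
    hf.mono (union_subset (subset_iUnion N n) (iUnion₂_subset fun k _ => subset_iUnion N k))
  rw [← union_sdiff_right, hinj.image_sdiff_subset subset_union_right, image_union,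
    union_sdiff_right]

/-- Cutting the union into disjoint pieces reduces a comparison of two images of it to subsets of
the single sets `N n`. -/
theorem measure_image_iUnion_eq_mul {α Y Z : Type*} [MeasurableSpace Y] [MeasurableSpace Z]
    {μ : Measure Y} {ν : Measure Z} {f : α → Y} {h : α → Z} {N : ℕ → Set α}
    (hf : InjOn f (⋃ n, N n)) (hh : InjOn h (⋃ n, N n)) (hfm : ∀ n, MeasurableSet (f '' N n))
    (hhm : ∀ n, MeasurableSet (h '' N n)) (a : ENNReal)
    (hN : ∀ n, ∀ D ⊆ N n, MeasurableSet (f '' D) → MeasurableSet (h '' D) →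
      μ (f '' D) = a * ν (h '' D)) :
    μ (f '' ⋃ n, N n) = a * ν (h '' ⋃ n, N n) := by
  have hfd (n : ℕ) : MeasurableSet (disjointed (fun n => f '' N n) n) := .disjointed hfm n
  have hhd (n : ℕ) : MeasurableSet (disjointed (fun n => h '' N n) n) := .disjointed hhm n
  rw [image_iUnion, image_iUnion, ← iUnion_disjointed (f := fun n => f '' N n),
    ← iUnion_disjointed (f := fun n => h '' N n), measure_iUnion (disjoint_disjointed _) hfd,
    measure_iUnion (disjoint_disjointed _) hhd, ← ENNReal.tsum_mul_left]
  refine tsum_congr fun n => ?_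
  simp only [← image_disjointed hf, ← image_disjointed hh] at hfd hhd ⊢
  exact hN n _ (disjointed_subset N n) (hfd n) (hhd n)

end Measure

section Pullback

theorem pullback_smul {M : Type v} {X : Type u} [MeasurableSpace M] [MeasurableSpace X]
    (f : M → X) (a : ENNReal) (ν : Measure X) :
    pullback f (a • ν) = a • pullback f ν := by
  simp only [pullback, Measure.bind, Measure.map_smul, Measure.join_smul]

theorem encard_fibre_inter_of_injOn {M X : Type*} {f : M → X} {B : Set M} (hf : InjOn f B)
    (y : X) : ((f ⁻¹' {y} ∩ B).encard : ENNReal) = (f '' B).indicator 1 y := by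
  rw [← (hf.mono inter_subset_right).encard_image, image_preimage_inter]
  by_cases hy : y ∈ f '' B
  · rw [singleton_inter_of_mem hy, indicator_of_mem hy, encard_singleton,
      ENat.toENNReal_one, Pi.one_apply]
  · rw [singleton_inter_of_notMem hy, indicator_of_notMem hy, encard_empty,
      ENat.toENNReal_zero]

variable {M : Type v} {X : Type u} [TopologicalSpace M] [TopologicalSpace X]
  [SecondCountableTopology M] [MeasurableSpace M] [BorelSpace M] [MeasurableSpace X] [BorelSpace X]
  {f : M → X}

theorem measurableSet_image_of_isLocalHomeomorph (hf : IsLocalHomeomorph f) {B : Set M}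
    (hB : MeasurableSet B) : MeasurableSet (f '' B) := by
  have hbasis := isTopologicalBasis_isOpen_injOn hf.isLocallyInjective
  obtain ⟨S, hSc, hS, hSu⟩ := isOpen_sUnion_countable _ fun U hU => hbasis.isOpen hU
  have hfB : f '' B = ⋃ U ∈ S, f '' (U ∩ B) := by
    rw [← image_iUnion₂, ← iUnion₂_inter, ← sUnion_eq_biUnion, hSu, hbasis.sUnion_eq, univ_inter]
  rw [hfB]
  refine .biUnion hSc fun U hU => ?_
  have hemb : Topology.IsOpenEmbedding (f ∘ (Subtype.val : U → M)) :=
    (hf.comp (hS hU).1.isOpenEmbedding_subtypeVal.isLocalHomeomorph)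
      |>.isOpenEmbedding_of_injective (injOn_iff_injective.1 (hS hU).2)
  rw [← Subtype.image_preimage_coe, ← image_comp]
  exact hemb.measurableEmbedding.measurableSet_image.2 (measurable_subtype_coe hB)

variable [T2Space M] [T2Space X]

theorem measurable_encard_fibre_inter (hf : IsLocalHomeomorph f) {B : Set M}
    (hB : MeasurableSet B) : Measurable fun y => ((f ⁻¹' {y} ∩ B).encard : ENNReal) := by
  convert (Measure.measurable_coe hB).comp (measurable_count_fibre hf) using 2 with y
  have hy : MeasurableSet (f ⁻¹' {y}) := (isClosed_singleton.preimage hf.continuous).measurableSet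
  rw [Function.comp_apply, Measure.restrict_apply hB, inter_comm,
    Measure.count_apply (hB.inter hy)]

theorem pullback_apply_of_injOn (hf : IsLocalHomeomorph f) (ν : Measure X) {B : Set M}
    (hB : MeasurableSet B) (hinj : InjOn f B) : pullback f ν B = ν (f '' B) := by
  simp only [pullback_apply hf ν hB, encard_fibre_inter_of_injOn hinj,
    lintegral_indicator_one (measurableSet_image_of_isLocalHomeomorph hf hB)]

theorem isLocallyFiniteMeasure_pullback (hf : IsLocalHomeomorph f) (ν : Measure X)
    [IsLocallyFiniteMeasure ν] : IsLocallyFiniteMeasure (pullback f ν) := by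
  refine ⟨fun x => ?_⟩
  obtain ⟨U, hU, hxU, hinj⟩ := hf.isLocallyInjective x
  obtain ⟨V, hxV, hV, hlt⟩ := ν.exists_isOpen_measure_lt_top (f x)
  have hUV : IsOpen (U ∩ f ⁻¹' V) := hU.inter (hV.preimage hf.continuous)
  refine ⟨_, hUV.mem_nhds ⟨hxU, hxV⟩, ?_⟩
  rw [pullback_apply_of_injOn hf ν hUV.measurableSet (hinj.mono inter_subset_left)]
  exact (measure_mono (image_subset_iff.2 inter_subset_right)).trans_lt hlt

theorem eq_pullback_of_isOpen (hf : IsLocalHomeomorph f) (ν : Measure X)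
    [IsLocallyFiniteMeasure ν] {ρ : Measure M}
    (h : ∀ U, IsOpen U → InjOn f U → ρ U = ν (f '' U)) : ρ = pullback f ν := by
  have := isLocallyFiniteMeasure_pullback hf ν
  refine (measure_ext_of_isTopologicalBasis
    (isTopologicalBasis_isOpen_injOn hf.isLocallyInjective) ?_ fun U hU => ?_).symm
  · exact fun U hU V hV _ => ⟨hU.1.inter hV.1, hU.2.mono inter_subset_left⟩
  · rw [h U hU.1 hU.2, pullback_apply_of_injOn hf ν hU.1.measurableSet hU.2]

theorem pullback_pullback {Z : Type*} [TopologicalSpace Z] [T2Space Z] [MeasurableSpace Z]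
    [BorelSpace Z] [SecondCountableTopology X] {g : X → Z} (hf : IsLocalHomeomorph f)
    (hg : IsLocalHomeomorph g) (ν : Measure Z) [IsLocallyFiniteMeasure ν] :
    pullback f (pullback g ν) = pullback (g ∘ f) ν := by
  refine eq_pullback_of_isOpen (hg.comp hf) ν fun U hU hinj => ?_
  rw [pullback_apply_of_injOn hf _ hU.measurableSet hinj.of_comp,
    pullback_apply_of_injOn hg _ (hf.isOpenMap U hU).measurableSet hinj.image_of_comp, image_comp]

theorem map_pullback_of_bijOn {M' X' : Type*} [TopologicalSpace M'] [TopologicalSpace X']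
    [SecondCountableTopology M'] [MeasurableSpace M'] [BorelSpace M'] [MeasurableSpace X']
    [BorelSpace X'] [T2Space M'] [T2Space X'] {f' : M' → X'} {a : M' → M} {b : X' → X}
    (hf : IsLocalHomeomorph f) (hf' : IsLocalHomeomorph f') (ha : Measurable a)
    (hb : Measurable b) (hab : ∀ y, BijOn a (f' ⁻¹' {y}) (f ⁻¹' {b y})) (ν : Measure X') :
    (pullback f' ν).map a = pullback f (ν.map b) := by
  ext B hB
  rw [Measure.map_apply ha hB, pullback_apply hf' ν (ha hB), pullback_apply hf _ hB,
    lintegral_map (measurable_encard_fibre_inter hf hB) hb]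
  refine lintegral_congr fun y => ?_
  rw [← (hab y).image_eq, ← image_inter_preimage,
    ((hab y).injOn.mono inter_subset_left).encard_image]

end Pullback
section ProjectiveLimit

/-- The maps `π i : Y → Z i` behave like the projections from the limit of a projective system of
spaces and proper maps, indexed by the directed relation `r`. The transition maps themselves
never enter, so only the dependence of `π i` on `π k` for `r i k` is recorded. -/
structure IsProperLimitCone {ι Y : Type*} {Z : ι → Type*} [TopologicalSpace Y]
    [∀ i, TopologicalSpace (Z i)] (r : ι → ι → Prop) (π : ∀ i, Y → Z i) : Prop where
  isProperMap : ∀ i, IsProperMap (π i)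
  factorsThrough : ∀ {i k}, r i k → (π i).FactorsThrough (π k)
  eq_of_forall_eq : ∀ {x y}, (∀ i, π i x = π i y) → x = y

/-- A family of measures on the spaces `Z i` that is projective on compact sets. Since images
under `π k` are measured, this includes that compact sets missing `range (π k)` are null sets
for `ρ k`. -/
def IsConsistentFamily {ι Y : Type*} {Z : ι → Type*} [∀ i, TopologicalSpace (Z i)]
    [∀ i, MeasurableSpace (Z i)] (r : ι → ι → Prop) (π : ∀ i, Y → Z i)
    (ρ : ∀ i, Measure (Z i)) : Prop :=
  ∀ ⦃i k⦄, r i k → ∀ ⦃C⦄, IsCompact C → ρ k (π k '' (π i ⁻¹' C)) = ρ i C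

/-- The value on a compact set `K` of the limit of the measures `ρ i`. -/
def limitValue {ι Y : Type*} {Z : ι → Type*} [∀ i, MeasurableSpace (Z i)] (π : ∀ i, Y → Z i)
    (ρ : ∀ i, Measure (Z i)) (K : Set Y) : ENNReal :=
  ⨅ i, ρ i (π i '' K)

theorem limitValue_mono {ι Y : Type*} {Z : ι → Type*} [∀ i, MeasurableSpace (Z i)]
    (π : ∀ i, Y → Z i) (ρ : ∀ i, Measure (Z i)) : Monotone (limitValue π ρ) :=
  fun _ _ h => iInf_mono fun _ => measure_mono (image_mono h)

namespace IsProperLimitCone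

variable {ι Y : Type*} {Z : ι → Type*} [TopologicalSpace Y] [∀ i, TopologicalSpace (Z i)]
  {r : ι → ι → Prop} {π : ∀ i, Y → Z i} (hπ : IsProperLimitCone r π)

include hπ

theorem isCompact_image (i : ι) {K : Set Y} (hK : IsCompact K) : IsCompact (π i '' K) :=
  hK.image (hπ.isProperMap i).continuous

theorem disjoint_image_of_rel {i k : ι} (hik : r i k) {K L : Set Y}
    (h : Disjoint (π i '' K) (π i '' L)) : Disjoint (π k '' K) (π k '' L) := by
  rw [disjoint_left] at h ⊢
  rintro _ ⟨x, hx, rfl⟩ ⟨y, hy, hxy⟩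
  exact h ⟨x, hx, rfl⟩ ⟨y, hy, hπ.factorsThrough hik hxy⟩

section Values

variable [∀ i, MeasurableSpace (Z i)] {ρ : ∀ i, Measure (Z i)}

theorem limitValue_ne_top [Nonempty ι] [∀ i, IsFiniteMeasureOnCompacts (ρ i)] {K : Set Y}
    (hK : IsCompact K) : limitValue π ρ K ≠ ⊤ := by
  obtain ⟨i⟩ := ‹Nonempty ι›
  exact ((iInf_le _ i).trans_lt (hπ.isCompact_image i hK).measure_lt_top).ne

variable (hρ : IsConsistentFamily r π ρ)

include hρ

theorem measure_image_le_of_rel {i k : ι} (hik : r i k) {K : Set Y} (hK : IsCompact K) :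
    ρ k (π k '' K) ≤ ρ i (π i '' K) :=
  (measure_mono (image_mono (subset_preimage_image _ _))).trans_eq
    (hρ hik (hπ.isCompact_image i hK))

variable [IsDirected ι r]

theorem limitValue_preimage (i : ι) {C : Set (Z i)} (hC : IsCompact C) :
    limitValue π ρ (π i ⁻¹' C) = ρ i C := by
  refine le_antisymm ?_ (le_iInf fun j => ?_)
  · obtain ⟨k, hik, -⟩ := directed_of r i i
    exact (iInf_le _ k).trans_eq (hρ hik hC)
  · obtain ⟨k, hik, hjk⟩ := directed_of r i j
    rw [← hρ hik hC]
    exact hπ.measure_image_le_of_rel hρ hjk ((hπ.isProperMap i).isCompact_preimage hC)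

theorem limitValue_add {K L : Set Y} (hK : IsCompact K) (hL : IsCompact L) :
    limitValue π ρ K + limitValue π ρ L = ⨅ i, (ρ i (π i '' K) + ρ i (π i '' L)) := by
  refine ENNReal.iInf_add_iInf fun i j => ?_
  obtain ⟨k, hik, hjk⟩ := directed_of r i j
  exact ⟨k, add_le_add (hπ.measure_image_le_of_rel hρ hik hK)
    (hπ.measure_image_le_of_rel hρ hjk hL)⟩

theorem limitValue_union_le {K L : Set Y} (hK : IsCompact K) (hL : IsCompact L) :
    limitValue π ρ (K ∪ L) ≤ limitValue π ρ K + limitValue π ρ L := by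
  rw [hπ.limitValue_add hρ hK hL]
  refine iInf_mono fun i => ?_
  rw [image_union]
  exact measure_union_le _ _

end Values

variable [IsDirected ι r] [Nonempty ι] [∀ i, T2Space (Z i)]

theorem exists_disjoint_image {K L : Set Y} (hK : IsCompact K) (hL : IsCompact L)
    (hKL : Disjoint K L) : ∃ i, Disjoint (π i '' K) (π i '' L) := by
  have hcont (i : ι) := (hπ.isProperMap i).continuous
  obtain ⟨i, hi⟩ := (hK.prod hL).elim_directed_cover
    (fun i => {z : Y × Y | π i z.1 ≠ π i z.2})
    (fun i => (isClosed_eq ((hcont i).comp continuous_fst)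
      ((hcont i).comp continuous_snd)).isOpen_compl)
    (fun z hz => mem_iUnion.2 <| not_forall.1 fun h =>
      disjoint_left.1 hKL hz.1 (hπ.eq_of_forall_eq h ▸ hz.2))
    (fun i j => by
      obtain ⟨k, hik, hjk⟩ := directed_of r i j
      exact ⟨k, fun z hz h => hz (hπ.factorsThrough hik h),
        fun z hz h => hz (hπ.factorsThrough hjk h)⟩)
  refine ⟨i, disjoint_left.2 ?_⟩
  rintro _ ⟨x, hx, rfl⟩ ⟨y, hy, hxy⟩
  exact hi (mk_mem_prod hx hy) hxy.symm

theorem exists_preimage_image_subset {K U : Set Y} (hK : IsCompact K) (hU : IsOpen U)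
    (hKU : K ⊆ U) : ∃ i, π i ⁻¹' (π i '' K) ⊆ U := by
  obtain ⟨i⟩ := ‹Nonempty ι›
  have hL : IsCompact (π i ⁻¹' (π i '' K) \ U) :=
    ((hπ.isProperMap i).isCompact_preimage (hπ.isCompact_image i hK)).diff hU
  obtain ⟨j, hj⟩ := hπ.exists_disjoint_image hK hL (disjoint_sdiff_right.mono_left hKU)
  obtain ⟨k, hik, hjk⟩ := directed_of r i j
  refine ⟨k, ?_⟩
  rintro y ⟨x, hx, hxy⟩
  by_contra hyU
  exact disjoint_left.1 hj ⟨x, hx, rfl⟩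
    ⟨y, ⟨⟨x, hx, hπ.factorsThrough hik hxy⟩, hyU⟩, (hπ.factorsThrough hjk hxy).symm⟩

variable [∀ i, MeasurableSpace (Z i)] [∀ i, BorelSpace (Z i)]

section Uniqueness

variable [MeasurableSpace Y] [BorelSpace Y]

theorem measure_eq_limitValue (μ : Measure Y) [μ.OuterRegular] {K : Set Y} (hK : IsCompact K) :
    μ K = limitValue π (fun i => μ.map (π i)) K := by
  have hmap (i : ι) : μ.map (π i) (π i '' K) = μ (π i ⁻¹' (π i '' K)) :=
    Measure.map_apply (hπ.isProperMap i).continuous.measurable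
      (hπ.isCompact_image i hK).measurableSet
  simp only [limitValue, hmap]
  refine le_antisymm (le_iInf fun i => measure_mono (subset_preimage_image _ _)) ?_
  rw [K.measure_eq_iInf_isOpen]
  refine le_iInf₂ fun U hKU => le_iInf fun hU => ?_
  obtain ⟨i, hi⟩ := hπ.exists_preimage_image_subset hK hU hKU
  exact (iInf_le _ i).trans (measure_mono hi)

theorem measure_ext {μ ν : Measure Y} [μ.Regular] [ν.Regular]
    (h : ∀ i, μ.map (π i) = ν.map (π i)) : μ = ν :=
  measure_ext_of_isCompact fun K hK => by
    simp only [hπ.measure_eq_limitValue _ hK, h]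

end Uniqueness

section Existence

variable {ρ : ∀ i, Measure (Z i)} (hρ : IsConsistentFamily r π ρ)

include hρ

theorem limitValue_union {K L : Set Y} (hK : IsCompact K) (hL : IsCompact L)
    (hKL : Disjoint K L) : limitValue π ρ (K ∪ L) = limitValue π ρ K + limitValue π ρ L := by
  refine le_antisymm (hπ.limitValue_union_le hρ hK hL) ?_
  rw [hπ.limitValue_add hρ hK hL]
  obtain ⟨i, hi⟩ := hπ.exists_disjoint_image hK hL hKL
  refine le_iInf fun j => ?_
  obtain ⟨k, hik, hjk⟩ := directed_of r i j
  refine (iInf_le _ k).trans ?_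
  rw [← measure_union (hπ.disjoint_image_of_rel hik hi) (hπ.isCompact_image k hL).measurableSet,
    ← image_union]
  exact hπ.measure_image_le_of_rel hρ hjk (hK.union hL)

/-- The content on `Y` with the values `limitValue π ρ`; the measure that it induces is the limit
of the measures `ρ i`. -/
def limitContent [∀ i, IsFiniteMeasureOnCompacts (ρ i)] : Content Y where
  toFun K := (limitValue π ρ K).toNNReal
  mono' K L h := ENNReal.toNNReal_mono (hπ.limitValue_ne_top L.isCompact) (limitValue_mono π ρ h)
  sup_disjoint' K L hKL _ _ := by
    rw [Compacts.coe_sup, hπ.limitValue_union hρ K.isCompact L.isCompact hKL,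
      ENNReal.toNNReal_add (hπ.limitValue_ne_top K.isCompact)
        (hπ.limitValue_ne_top L.isCompact)]
  sup_le' K L := by
    have hK := hπ.limitValue_ne_top (ρ := ρ) K.isCompact
    have hL := hπ.limitValue_ne_top (ρ := ρ) L.isCompact
    rw [Compacts.coe_sup, ← ENNReal.toNNReal_add hK hL]
    exact ENNReal.toNNReal_mono (ENNReal.add_ne_top.2 ⟨hK, hL⟩)
      (hπ.limitValue_union_le hρ K.isCompact L.isCompact)

theorem limitContent_apply [∀ i, IsFiniteMeasureOnCompacts (ρ i)] (K : Compacts Y) :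
    hπ.limitContent hρ K = limitValue π ρ K :=
  ENNReal.coe_toNNReal (hπ.limitValue_ne_top K.isCompact)

variable [∀ i, LocallyCompactSpace (Z i)] [∀ i, (ρ i).Regular]

theorem contentRegular_limitContent : (hπ.limitContent hρ).ContentRegular := by
  intro K
  refine le_antisymm
    (le_iInf₂ fun L hL => (hπ.limitContent hρ).mono _ _ (hL.trans interior_subset)) ?_
  rw [hπ.limitContent_apply]
  refine le_iInf fun i => le_of_forall_gt fun x hx => ?_
  obtain ⟨U, hKU, hU, hUx⟩ := Set.exists_isOpen_lt_of_lt _ x hx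
  obtain ⟨C, hC, hKC, hCU⟩ := exists_compact_between (hπ.isCompact_image i K.isCompact) hU hKU
  let L : Compacts Y := ⟨π i ⁻¹' C, (hπ.isProperMap i).isCompact_preimage hC⟩
  have hKL : (K : Set Y) ⊆ interior L := (image_subset_iff.1 hKC).trans
    (preimage_interior_subset_interior_preimage (hπ.isProperMap i).continuous)
  calc ⨅ L : Compacts Y, ⨅ _ : (K : Set Y) ⊆ interior L, (hπ.limitContent hρ L : ENNReal)
      ≤ hπ.limitContent hρ L := iInf₂_le L hKL
    _ = limitValue π ρ L := hπ.limitContent_apply hρ L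
    _ ≤ ρ i (π i '' L) := iInf_le _ i
    _ ≤ ρ i U := measure_mono ((image_preimage_subset _ _).trans hCU)
    _ < x := hUx

theorem exists_regular_map_eq [T2Space Y] [LocallyCompactSpace Y] [MeasurableSpace Y]
    [BorelSpace Y] :
    ∃ μ : Measure Y, μ.Regular ∧ ∀ i, μ.map (π i) = ρ i := by
  refine ⟨(hπ.limitContent hρ).measure, inferInstance, fun i => ?_⟩
  have := regular_map_of_isProperMap (hπ.isProperMap i) (hπ.limitContent hρ).measure
  refine measure_ext_of_isCompact fun C hC => ?_
  have hC' := (hπ.isProperMap i).isCompact_preimage hC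
  rw [Measure.map_apply (hπ.isProperMap i).continuous.measurable hC.measurableSet,
    ← hπ.limitValue_preimage hρ i hC]
  exact ((hπ.limitContent hρ).measure_eq_content_of_regular
    (hπ.contentRegular_limitContent hρ) ⟨_, hC'⟩).trans (hπ.limitContent_apply hρ _)

end Existence

end IsProperLimitCone

end ProjectiveLimit

namespace RightOreMonoid

variable {P : Type w} [Monoid P] [RightOreMonoid P]

instance isDirected_dvd : IsDirected P (· ∣ ·) where
  directed p q := by
    obtain ⟨a, b, h⟩ := exists_mul_eq p q
    exact ⟨p * a, dvd_mul_right p a, h ▸ dvd_mul_right q b⟩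

theorem exists_forall_mul_eq_mul (S : Finset (P × P)) (hS : ∀ x ∈ S, ∃ a : P, a * x.1 = a * x.2) :
    ∃ z, ∀ x ∈ S, x.1 * z = x.2 * z := by
  classical
  induction S using Finset.induction_on with
  | empty => exact ⟨1, by simp⟩
  | insert x S _ ih =>
    obtain ⟨z, hz⟩ := ih fun y hy => hS y (Finset.mem_insert_of_mem hy)
    obtain ⟨a, ha⟩ := hS x (Finset.mem_insert_self x S)
    obtain ⟨w, hw⟩ := exists_mul_eq_of_mul_eq a (x.1 * z) (x.2 * z) (by
      rw [← mul_assoc, ha, mul_assoc])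
    refine ⟨z * w, fun y hy => ?_⟩
    rcases Finset.mem_insert.1 hy with rfl | hy
    · rw [← mul_assoc, hw, mul_assoc]
    · rw [← mul_assoc, hz y hy, mul_assoc]

/-- The category with objects `a` and arrows `b : a → a * b` is filtered: the `f a` are the legs of
a cocone over a finite diagram. -/
theorem exists_forall_mul_apply_eq (S : Finset (P × P)) :
    ∃ (t : P) (f : P → P), ∀ x ∈ S, x.1 * f x.1 = t ∧ f x.1 = x.2 * f (x.1 * x.2) := by
  classical
  let vertices : Finset P := S.image Prod.fst ∪ S.image fun x => x.1 * x.2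
  obtain ⟨t, ht⟩ := directed_id.finset_le (r := (· ∣ ·)) vertices
  have hleg (a : P) : ∃ b, a ∈ vertices → a * b = t := by
    by_cases ha : a ∈ vertices
    · obtain ⟨b, hb⟩ := ht a ha
      exact ⟨b, fun _ => hb.symm⟩
    · exact ⟨1, fun h => absurd h ha⟩
  choose f hf using hleg
  have hfst {x : P × P} (hx : x ∈ S) : x.1 * f x.1 = t :=
    hf _ (Finset.mem_union_left _ (Finset.mem_image_of_mem _ hx))
  have hmul {x : P × P} (hx : x ∈ S) : x.1 * x.2 * f (x.1 * x.2) = t :=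
    hf _ (Finset.mem_union_right _ (Finset.mem_image_of_mem (fun x : P × P => x.1 * x.2) hx))
  obtain ⟨z, hz⟩ := exists_forall_mul_eq_mul
    (S.image fun x => (f x.1, x.2 * f (x.1 * x.2))) (by
      intro y hy
      obtain ⟨x, hx, rfl⟩ := Finset.mem_image.1 hy
      exact ⟨x.1, by rw [hfst hx, ← mul_assoc, hmul hx]⟩)
  refine ⟨t * z, fun a => f a * z, fun x hx => ⟨by rw [← mul_assoc, hfst hx], ?_⟩⟩
  exact (hz _ (Finset.mem_image_of_mem (fun x : P × P => (f x.1, x.2 * f (x.1 * x.2))) hx)).trans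
    (mul_assoc _ _ _)

end RightOreMonoid

namespace ProperCorrAction

variable {P : Type w} [Monoid P] {X : Type u} [TopologicalSpace X]
  {M : P → Type v} [∀ p, TopologicalSpace (M p)] (A : ProperCorrAction P X M)

section Structure

variable {p q t a b d : P}

theorem continuous_rr (h : p * q = t) : Continuous (A.rr h) :=
  continuous_fst.comp (continuous_subtype_val.comp (A.σ h).continuous)

theorem continuous_ss (h : p * q = t) : Continuous (A.ss h) :=
  continuous_snd.comp (continuous_subtype_val.comp (A.σ h).continuous)

theorem s_rr (h : p * q = t) (m : M t) : A.s p (A.rr h m) = A.r q (A.ss h m) := (A.σ h m).2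

theorem rr_one (h : p * 1 = p) (m : M p) : A.rr h m = m := A.σ_mul_one p m

theorem ss_one (h : 1 * p = p) (m : M p) : A.ss h m = m := A.σ_one_mul p m

theorem rr_rr (hpq : p * q = a) (hat : a * t = d) (hqt : q * t = b) (hpb : p * b = d) (m : M d) :
    A.rr hpq (A.rr hat m) = A.rr hpb m := (A.assoc hpq hat hqt hpb m).1

theorem ss_rr (hpq : p * q = a) (hat : a * t = d) (hqt : q * t = b) (hpb : p * b = d) (m : M d) :
    A.ss hpq (A.rr hat m) = A.rr hqt (A.ss hpb m) := (A.assoc hpq hat hqt hpb m).2.1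

theorem ss_ss (hpq : p * q = a) (hat : a * t = d) (hqt : q * t = b) (hpb : p * b = d) (m : M d) :
    A.ss hqt (A.ss hpb m) = A.ss hat m := (A.assoc hpq hat hqt hpb m).2.2.symm

theorem r_rr (h : p * q = t) (m : M t) : A.r p (A.rr h m) = A.r t m := by
  have hp := A.s_rr (one_mul p) (A.rr h m)
  have ht := A.s_rr (one_mul t) m
  rw [ss_one] at hp ht
  rw [← hp, ← ht, A.rr_rr (one_mul p) h h (one_mul t)]

theorem s_ss (h : p * q = t) (m : M t) : A.s q (A.ss h m) = A.s t m := by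
  have hq := A.s_rr (mul_one q) (A.ss h m)
  have ht := A.s_rr (mul_one t) m
  rw [rr_one] at hq ht
  rw [hq, ht, A.ss_ss h (mul_one t) (mul_one q) h]

theorem ext_rr_ss (h : p * q = t) {m m' : M t} (hr : A.rr h m = A.rr h m')
    (hs : A.ss h m = A.ss h m') : m = m' :=
  (A.σ h).injective (Subtype.ext (Prod.ext hr hs))

theorem rr_σ_symm (h : p * q = t) (x) : A.rr h ((A.σ h).symm x) = x.1.1 := by
  simp only [rr, Homeomorph.apply_symm_apply]

theorem ss_σ_symm (h : p * q = t) (x) : A.ss h ((A.σ h).symm x) = x.1.2 := by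
  simp only [ss, Homeomorph.apply_symm_apply]

theorem isLocalHomeomorph_ss (h : p * q = t) : IsLocalHomeomorph (A.ss h) :=
  (isLocalHomeomorph_pullback_snd (A.isLocalHomeomorph_s p) (A.isProperMap_r q).continuous).comp
    (A.σ h).isLocalHomeomorph

theorem bijOn_rr (h : p * q = t) (y : M q) :
    BijOn (A.rr h) (A.ss h ⁻¹' {y}) (A.s p ⁻¹' {A.r q y}) :=
  bijOn_fst_fibre (A.σ h).toEquiv y

end Structure

section Histories

/-- The projection `H⁰ → M p`, `m ↦ m_p`. -/
def proj (p : P) (m : A.H0) : M p := m.1 p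

variable {A} in
theorem H0_ext {m m' : A.H0} (h : ∀ p, A.proj p m = A.proj p m') : m = m' :=
  Subtype.ext (funext h)

theorem continuous_proj (p : P) : Continuous (A.proj p) :=
  (continuous_apply p).comp continuous_subtype_val

theorem rr_proj {p q t : P} (h : p * q = t) (m : A.H0) : A.rr h (A.proj t m) = A.proj p m := by
  subst h
  exact m.2 p q

theorem ss_proj {p q t : P} (h : p * q = t) (m : A.H0) :
    A.ss h (A.proj t m) = A.proj q (A.shift p m) := by
  subst h
  rfl

theorem r_proj (p : P) (m : A.H0) : A.r p (A.proj p m) = A.π₁ m := by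
  rw [← A.r_rr (one_mul p), rr_proj, π₁, proj]

theorem s_proj (p : P) (m : A.H0) : A.s p (A.proj p m) = A.π₁ (A.shift p m) := by
  rw [← A.rr_proj (mul_one p), s_rr, ss_proj, r_proj]

theorem continuous_π₁ : Continuous A.π₁ :=
  (A.isProperMap_r 1).continuous.comp (A.continuous_proj 1)

theorem continuous_shift (t : P) : Continuous (A.shift t) :=
  Continuous.subtype_mk (continuous_pi fun p =>
    (A.continuous_ss rfl).comp (A.continuous_proj (t * p))) _

theorem shift_shift {p q t : P} (h : p * q = t) (m : A.H0) :
    A.shift q (A.shift p m) = A.shift t m :=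
  H0_ext fun a => by
    have ha : p * (q * a) = t * a := by rw [← h, mul_assoc]
    rw [← A.ss_proj rfl, ← A.ss_proj ha, ← A.ss_proj rfl, A.ss_ss h rfl rfl ha]

variable [RightOreMonoid P]

section Extension

variable {A} {p : P} {x : ∀ q, M (p * q)}

theorem rr_eq_rr_of_compatible (hx : ∀ q d, A.rr (mul_assoc p q d) (x (q * d)) = x q)
    {a b b' q q' : P} (h : a * b = p * q) (h' : a * b' = p * q') :
    A.rr h (x q) = A.rr h' (x q') := by
  have hx' {q d e : P} (hqd : q * d = e) (he : p * q * d = p * e) : A.rr he (x e) = x q := by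
    subst hqd
    exact hx q d
  obtain ⟨y, y', hy⟩ := RightOreMonoid.exists_mul_eq q q'
  obtain ⟨z, hz⟩ := RightOreMonoid.exists_mul_eq_of_mul_eq a (b * y) (b' * y') (by
    rw [← mul_assoc, h, ← mul_assoc, h', mul_assoc, hy, mul_assoc])
  have hq : q * (y * z) = q * y * z := (mul_assoc _ _ _).symm
  have hq' : q' * (y' * z) = q * y * z := by rw [hy, mul_assoc]
  have hpq : p * q * (y * z) = p * (q * y * z) := by rw [← hq, mul_assoc]
  have hpq' : p * q' * (y' * z) = p * (q * y * z) := by rw [← hq', mul_assoc]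
  have ha : a * (b * y * z) = p * (q * y * z) := by
    rw [mul_assoc b, ← mul_assoc a, h, hpq]
  rw [← hx' hq hpq, ← hx' hq' hpq', A.rr_rr h hpq (mul_assoc _ _ _).symm ha,
    A.rr_rr h' hpq' (by rw [hz, mul_assoc]) ha]

variable (A x)

/-- The history extending a compatible family in the spaces `M (p q)`. Its component in `M a` is
found from any common multiple `a b = p q`. -/
def extendHistory (hx : ∀ q d, A.rr (mul_assoc p q d) (x (q * d)) = x q) : A.H0 :=
  ⟨fun a => A.rr (RightOreMonoid.exists_mul_eq a p).choose_spec.choose_spec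
      (x (RightOreMonoid.exists_mul_eq a p).choose_spec.choose), fun a b => by
    have h := (RightOreMonoid.exists_mul_eq (a * b) p).choose_spec.choose_spec
    exact (A.rr_rr rfl h rfl ((mul_assoc _ _ _).symm.trans h) _).trans
      (rr_eq_rr_of_compatible hx _ _)⟩

theorem proj_extendHistory (hx : ∀ q d, A.rr (mul_assoc p q d) (x (q * d)) = x q)
    {a b q : P} (h : a * b = p * q) : A.proj a (A.extendHistory x hx) = A.rr h (x q) :=
  rr_eq_rr_of_compatible hx _ _

end Extension

/-- The history beginning with `z.1 ∈ M p` and continuing with the history `z.2`. -/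
def concat (p : P) (z : {z : M p × A.H0 // A.s p z.1 = A.π₁ z.2}) : A.H0 :=
  A.extendHistory
    (fun q => (A.σ rfl).symm ⟨(z.1.1, A.proj q z.1.2), z.2.trans (A.r_proj q z.1.2).symm⟩)
    fun q d => by
      refine A.ext_rr_ss rfl ?_ ?_
      · rw [A.rr_rr rfl _ rfl rfl, rr_σ_symm, rr_σ_symm]
      · rw [A.ss_rr rfl _ rfl rfl, ss_σ_symm, ss_σ_symm, rr_proj]

theorem proj_concat {p : P} (z : {z : M p × A.H0 // A.s p z.1 = A.π₁ z.2}) {a b q : P}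
    (h : a * b = p * q) : A.proj a (A.concat p z) = A.rr h ((A.σ rfl).symm
      ⟨(z.1.1, A.proj q z.1.2), z.2.trans (A.r_proj q z.1.2).symm⟩) :=
  A.proj_extendHistory _ _ h

theorem continuous_concat (p : P) : Continuous (A.concat p) :=
  Continuous.subtype_mk (continuous_pi fun _ => (A.continuous_rr _).comp
    ((A.σ rfl).symm.continuous.comp (Continuous.subtype_mk
      ((continuous_fst.comp continuous_subtype_val).prodMk
        ((A.continuous_proj _).comp (continuous_snd.comp continuous_subtype_val))) _))) _

/-- A history is given by its first `p` steps and the history after these. -/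
def historyHomeomorph (p : P) : A.H0 ≃ₜ {z : M p × A.H0 // A.s p z.1 = A.π₁ z.2} where
  toFun m := ⟨(A.proj p m, A.shift p m), A.s_proj p m⟩
  invFun := A.concat p
  left_inv m := H0_ext fun a => by
    obtain ⟨b, q, h⟩ := RightOreMonoid.exists_mul_eq a p
    rw [A.proj_concat _ h, ← A.rr_proj h m]
    congr 1
    refine A.ext_rr_ss rfl ?_ ?_
    · rw [rr_σ_symm, rr_proj]
    · rw [ss_σ_symm, ss_proj]
  right_inv z := by
    refine Subtype.ext (Prod.ext ?_ (H0_ext fun q => ?_))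
    · exact (A.proj_concat z (rfl : p * 1 = p * 1)).trans (A.rr_σ_symm rfl _)
    · rw [← A.ss_proj rfl, A.proj_concat z (mul_one (p * q)), rr_one, ss_σ_symm]
  continuous_toFun := ((A.continuous_proj p).prodMk (A.continuous_shift p)).subtype_mk _
  continuous_invFun := A.continuous_concat p

theorem isLocalHomeomorph_shift (p : P) : IsLocalHomeomorph (A.shift p) :=
  (isLocalHomeomorph_pullback_snd (A.isLocalHomeomorph_s p) A.continuous_π₁).comp
    (A.historyHomeomorph p).isLocalHomeomorph

theorem bijOn_proj (p : P) (y : A.H0) :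
    BijOn (A.proj p) (A.shift p ⁻¹' {y}) (A.s p ⁻¹' {A.π₁ y}) :=
  bijOn_fst_fibre (A.historyHomeomorph p).toEquiv y

theorem bijOn_proj_mul (p q : P) (y : A.H0) :
    BijOn (A.proj (p * q)) (A.shift p ⁻¹' {y}) (A.ss rfl ⁻¹' {A.proj q y}) := by
  have hp : BijOn (A.rr rfl ∘ A.proj (p * q)) (A.shift p ⁻¹' {y}) (A.s p ⁻¹' {A.π₁ y}) :=
    (A.bijOn_proj p y).congr fun m _ => (A.rr_proj rfl m).symm
  have hrr : BijOn (A.rr rfl) (A.ss rfl ⁻¹' {A.proj q y}) (A.s p ⁻¹' {A.π₁ y}) :=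
    A.r_proj q y ▸ A.bijOn_rr rfl (A.proj q y)
  have hmaps : MapsTo (A.proj (p * q)) (A.shift p ⁻¹' {y}) (A.ss rfl ⁻¹' {A.proj q y}) := by
    rintro m rfl
    exact A.ss_proj rfl m
  refine ⟨hmaps, hp.injOn.of_comp, fun u hu => ?_⟩
  obtain ⟨m, hm, hmu⟩ := hp.surjOn (hrr.mapsTo hu)
  exact ⟨m, hm, hrr.injOn (hmaps hm) hu hmu⟩

end Histories

end ProperCorrAction

namespace ProperCorrAction

variable {P : Type w} [Monoid P] {X : Type u} [TopologicalSpace X]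
  {M : P → Type v} [∀ p, TopologicalSpace (M p)] (A : ProperCorrAction P X M)

section Compactness

theorem secondCountableTopology_H0 [T2Space X] [LocallyCompactSpace X]
    [SecondCountableTopology X] [Countable P] : SecondCountableTopology A.H0 := by
  have := A.secondCountable_M
  exact (Topology.IsEmbedding.subtypeVal : Topology.IsEmbedding
    (Subtype.val : A.H0 → ∀ p, M p)).secondCountableTopology

theorem isClosedEmbedding_val [∀ p, T2Space (M p)] :
    Topology.IsClosedEmbedding (Subtype.val : A.H0 → ∀ p, M p) := by
  have hclosed :
      IsClosed {m : ∀ p, M p | ∀ p q : P, A.rr (rfl : p * q = p * q) (m (p * q)) = m p} := by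
    simp only [ofPred_forall]
    exact isClosed_iInter fun p => isClosed_iInter fun q =>
      isClosed_eq ((A.continuous_rr _).comp (continuous_apply _)) (continuous_apply _)
  exact hclosed.isClosedEmbedding_subtypeVal

instance [∀ p, T2Space (M p)] : T2Space A.H0 := inferInstanceAs (T2Space (Subtype _))

section ProperProjections

variable [T2Space X] [LocallyCompactSpace X] [∀ p, T2Space (M p)]

theorem isProperMap_π₁ : IsProperMap A.π₁ := by
  rw [isProperMap_iff_isCompact_preimage]
  refine ⟨A.continuous_π₁, fun K hK => ?_⟩
  have hprod := A.isClosedEmbedding_val.isCompact_preimage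
    (isCompact_univ_pi fun p => (A.isProperMap_r p).isCompact_preimage hK)
  have hpre : A.π₁ ⁻¹' K ⊆ Subtype.val ⁻¹' univ.pi fun p => A.r p ⁻¹' K := fun m hm p _ => by
    change A.r p (A.proj p m) ∈ K
    rwa [r_proj]
  exact hprod.of_isClosed_subset (hK.isClosed.preimage A.continuous_π₁) hpre

theorem isProperMap_proj (p : P) : IsProperMap (A.proj p) := by
  refine isProperMap_of_comp_of_t2 (A.continuous_proj p) (A.isProperMap_r p).continuous ?_
  rw [show A.r p ∘ A.proj p = A.π₁ from funext (A.r_proj p)]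
  exact A.isProperMap_π₁

theorem locallyCompactSpace_H0 : LocallyCompactSpace A.H0 := by
  have := weaklyLocallyCompactSpace_of_isProperMap A.isProperMap_π₁
  infer_instance

theorem isProperLimitCone_proj : IsProperLimitCone (· ∣ ·) A.proj where
  isProperMap := A.isProperMap_proj
  factorsThrough := by
    rintro p _ ⟨q, rfl⟩ x y hxy
    rw [← A.rr_proj rfl x, ← A.rr_proj rfl y, hxy]
  eq_of_forall_eq := H0_ext

end ProperProjections

variable [RightOreMonoid P]

theorem exists_partial_history {p : P} {K : Set (M p)}
    (hK : ∀ d, ∃ y : M (p * d), A.rr rfl y ∈ K) (S : Finset (P × P)) :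
    ∃ m : ∀ a, M a, (∀ a, A.r a (m a) ∈ A.r p '' K) ∧ m p ∈ K ∧
      ∀ x ∈ S, A.rr (rfl : x.1 * x.2 = x.1 * x.2) (m (x.1 * x.2)) = m x.1 := by
  classical
  obtain ⟨t, f, hf⟩ := RightOreMonoid.exists_forall_mul_apply_eq (insert (p, 1) S)
  obtain rfl : p * f p = t := (hf _ (Finset.mem_insert_self _ _)).1
  obtain ⟨y, hy⟩ := hK (f p)
  have hm (a : P) : ∃ ma : M a, A.r a ma ∈ A.r p '' K ∧
      ∀ h : a * f a = p * f p, ma = A.rr h y := by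
    by_cases h : a * f a = p * f p
    · exact ⟨A.rr h y, ⟨_, hy, by rw [r_rr, r_rr]⟩, fun _ => rfl⟩
    · obtain ⟨b, d, hbd⟩ := RightOreMonoid.exists_mul_eq a p
      obtain ⟨u, hu⟩ := hK d
      exact ⟨A.rr hbd u, ⟨_, hu, by rw [r_rr, r_rr]⟩, fun h' => absurd h' h⟩
  choose m hmK hm using hm
  refine ⟨m, hmK, hm p rfl ▸ hy, fun x hx => ?_⟩
  obtain ⟨hx₁, hx₂⟩ := hf x (Finset.mem_insert_of_mem hx)
  have hx₁₂ : x.1 * x.2 * f (x.1 * x.2) = p * f p := by rw [mul_assoc, ← hx₂, hx₁]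
  rw [hm _ hx₁, hm _ hx₁₂]
  exact A.rr_rr rfl hx₁₂ hx₂.symm hx₁ y

theorem exists_proj_mem_of_forall_exists_rr_mem [∀ p, T2Space (M p)] {p : P} {K : Set (M p)}
    (hK : IsCompact K) (h : ∀ d, ∃ y : M (p * d), A.rr rfl y ∈ K) :
    ∃ m : A.H0, A.proj p m ∈ K := by
  let Q : Set (∀ a, M a) := univ.pi (fun a => A.r a ⁻¹' (A.r p '' K)) ∩ {m | m p ∈ K}
  have hQ : IsCompact Q :=
    (isCompact_univ_pi fun a => (A.isProperMap_r a).isCompact_preimage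
      (hK.image (A.isProperMap_r p).continuous)).inter_right
      (hK.isClosed.preimage (continuous_apply p))
  obtain ⟨m, ⟨-, hmK⟩, hm⟩ := hQ.inter_iInter_nonempty
    (fun x : P × P => {m | A.rr (rfl : x.1 * x.2 = x.1 * x.2) (m (x.1 * x.2)) = m x.1})
    (fun x => isClosed_eq ((A.continuous_rr _).comp (continuous_apply _)) (continuous_apply _))
    (fun S => by
      obtain ⟨m, hmr, hmK, hmS⟩ := A.exists_partial_history h S
      exact ⟨m, ⟨fun a _ => hmr a, hmK⟩, mem_iInter₂.2 hmS⟩)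
  exact ⟨⟨m, fun a b => mem_iInter.1 hm (a, b)⟩, hmK⟩

end Compactness

section ProjectiveFamily

variable [RightOreMonoid P] [T2Space X] [LocallyCompactSpace X] [∀ p, T2Space (M p)]
  [∀ p, MeasurableSpace (M p)] [∀ p, BorelSpace (M p)]

theorem measure_ext_of_map_proj_mul (p : P) {μ μ' : Measure A.H0} [μ.Regular] [μ'.Regular]
    (h : ∀ q, μ.map (A.proj (p * q)) = μ'.map (A.proj (p * q))) : μ = μ' :=
  A.isProperLimitCone_proj.measure_ext fun a => by
    obtain ⟨b, q, hab⟩ := RightOreMonoid.exists_mul_eq a p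
    have hmap (μ : Measure A.H0) : μ.map (A.proj a) = (μ.map (A.proj (p * q))).map (A.rr hab) := by
      rw [Measure.map_map (A.continuous_rr hab).measurable (A.continuous_proj _).measurable]
      exact congrArg μ.map (funext fun m => (A.rr_proj hab m).symm)
    rw [hmap, hmap, h]

variable {ρ : ∀ p, Measure (M p)} [∀ p, (ρ p).Regular]
  (hρ : ∀ {p q t : P} (h : p * q = t), (ρ t).map (A.rr h) = ρ p)

include hρ

theorem measure_compl_range_proj (p : P) : ρ p (Set.range (A.proj p))ᶜ = 0 := by
  rw [(A.isProperMap_proj p).isClosedMap.isClosed_range.isOpen_compl.measure_eq_iSup_isCompact]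
  refine le_antisymm (iSup₂_le fun K hKp => iSup_le fun hK => ?_) zero_le
  obtain ⟨d, hd⟩ : ∃ d, ∀ y : M (p * d), A.rr rfl y ∉ K := by
    by_contra! h
    obtain ⟨m, hm⟩ := A.exists_proj_mem_of_forall_exists_rr_mem hK h
    exact hKp hm (mem_range_self m)
  rw [← hρ (rfl : p * d = p * d), Measure.map_apply (A.continuous_rr rfl).measurable
    hK.measurableSet, preimage_eq_empty_iff.2 (disjoint_right.2 ?_), measure_empty]
  rintro _ ⟨y, rfl⟩
  exact hd y

theorem isConsistentFamily_proj : IsConsistentFamily (· ∣ ·) A.proj ρ := by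
  rintro p _ ⟨q, rfl⟩ C hC
  have himage : A.proj (p * q) '' (A.proj p ⁻¹' C) =
      A.rr rfl ⁻¹' C ∩ Set.range (A.proj (p * q)) := by
    rw [← image_preimage_eq_inter_range, ← preimage_comp]
    exact congrArg (fun f => A.proj (p * q) '' (f ⁻¹' C)) (funext fun m => (A.rr_proj rfl m).symm)
  rw [himage, measure_inter_conull, ← hρ (rfl : p * q = p * q),
    Measure.map_apply (A.continuous_rr rfl).measurable hC.measurableSet]
  exact A.measure_compl_range_proj hρ (p * q)

theorem exists_regular_map_proj_eq [∀ p, LocallyCompactSpace (M p)] :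
    ∃ μ : Measure A.H0, μ.Regular ∧ ∀ p, μ.map (A.proj p) = ρ p :=
  have := A.locallyCompactSpace_H0
  A.isProperLimitCone_proj.exists_regular_map_eq (A.isConsistentFamily_proj hρ)

end ProjectiveFamily

end ProperCorrAction

theorem ofReal_val_mul (x y : {x : ℝ // 0 < x}) :
    ENNReal.ofReal ((x * y : {x : ℝ // 0 < x}) : ℝ) = ENNReal.ofReal x * ENNReal.ofReal y :=
  ENNReal.ofReal_mul x.2.le

theorem FracGroup.extend_mk {P : Type w} [Monoid P] [RightOreMonoid P] (c : P →* {x : ℝ // 0 < x})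
    (p q : P) : FracGroup.extend c (FracGroup.mk p q) = c p / c q := rfl

namespace ProperCorrAction

variable {P : Type w} [Monoid P] {X : Type u} [TopologicalSpace X]
  {M : P → Type v} [∀ p, TopologicalSpace (M p)] (A : ProperCorrAction P X M)

/-- Invariance of a measure on `H⁰` under the shifts, `μ = c(p) s̃_p^* μ`. By
`isInvariantH0_iff_isShiftInvariant` it amounts to `c`-invariance. -/
def IsShiftInvariant (c : P →* {x : ℝ // 0 < x}) (μ : Measure A.H0) : Prop :=
  ∀ p, μ = ENNReal.ofReal (c p) • pullback (A.shift p) μ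

theorem shift_one (m : A.H0) : A.shift 1 m = m :=
  H0_ext fun p => by rw [← A.ss_proj (one_mul p), ss_one]

variable [RightOreMonoid P]

section Bisections

variable {A} in
theorem H1_ext {a b : A.H1} (hrange : A.range a = A.range b) (hdegree : A.degree a = A.degree b)
    (hsource : A.source a = A.source b) : a = b :=
  Subtype.ext (Prod.ext hrange (Prod.ext hdegree hsource))

/-- The arrows `(x, p₁ p₂⁻¹, y)` with `x ∈ U`, `y ∈ V` and `s̃_{p₁} x = s̃_{p₂} y`; these sets are
used as basic open sets of `H¹`. -/
def arrowBox (p₁ p₂ : P) (U V : Set A.H0) : Set A.H1 :=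
  {a | A.degree a = FracGroup.mk p₁ p₂ ∧ A.range a ∈ U ∧ A.source a ∈ V ∧
    A.shift p₁ (A.range a) = A.shift p₂ (A.source a)}

variable {p₁ p₂ : P} {U V : Set A.H0}

theorem isOpen_arrowBox (hU : IsOpen U) (hV : IsOpen V) : IsOpen (A.arrowBox p₁ p₂ U V) := by
  rw [isOpen_coinduced, isOpen_sigma_iff]
  rintro ⟨q₁, q₂⟩
  by_cases hq : FracGroup.mk q₁ q₂ = FracGroup.mk p₁ p₂
  · obtain ⟨t, t', h₁ : q₁ * t = p₁ * t', h₂ : q₂ * t = p₂ * t'⟩ := Quotient.exact hq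
    have hfst : Continuous fun z : A.H1Piece q₁ q₂ => z.1.1 :=
      continuous_fst.comp continuous_subtype_val
    have hsnd : Continuous fun z : A.H1Piece q₁ q₂ => z.1.2 :=
      continuous_snd.comp continuous_subtype_val
    -- On this piece both sides have the same image under the locally injective map `s̃_{t'}`.
    have hlocus : IsOpen {z : A.H1Piece q₁ q₂ | A.shift p₁ z.1.1 = A.shift p₂ z.1.2} := by
      refine (A.isLocalHomeomorph_shift t').isLocallyInjective.isOpen_eqLocus
        ((A.continuous_shift p₁).comp hfst) ((A.continuous_shift p₂).comp hsnd)
        (funext fun z => ?_)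
      have hz := congrArg (A.shift t) z.2
      rw [A.shift_shift h₁, A.shift_shift h₂] at hz
      exact (A.shift_shift rfl z.1.1).trans (hz.trans (A.shift_shift rfl z.1.2).symm)
    convert (hU.preimage hfst).inter ((hV.preimage hsnd).inter hlocus) using 1
    ext z
    exact and_iff_right hq
  · convert isOpen_empty using 1
    exact eq_empty_of_forall_notMem fun z hz => hq hz.1

theorem isBisection_arrowBox (hU : IsOpen U) (hV : IsOpen V) (hinjU : InjOn (A.shift p₁) U)
    (hinjV : InjOn (A.shift p₂) V) : A.IsBisection (A.arrowBox p₁ p₂ U V) := by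
  refine ⟨A.isOpen_arrowBox hU hV, ?_, ?_⟩
  · rintro a ⟨hga, -, hVa, ha⟩ b ⟨hgb, -, hVb, hb⟩ hab
    exact H1_ext hab (hga.trans hgb.symm) (hinjV hVa hVb (by rw [← ha, ← hb, hab]))
  · rintro a ⟨hga, hUa, -, ha⟩ b ⟨hgb, hUb, -, hb⟩ hab
    exact H1_ext (hinjU hUa hUb (by rw [ha, hb, hab])) (hga.trans hgb.symm) hab

theorem image_range_arrowBox :
    A.range '' A.arrowBox p₁ p₂ U V = U ∩ A.shift p₁ ⁻¹' (A.shift p₂ '' V) := by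
  ext x
  constructor
  · rintro ⟨a, ⟨-, hU, hV, h⟩, rfl⟩
    exact ⟨hU, A.source a, hV, h.symm⟩
  · rintro ⟨hU, y, hV, h⟩
    exact ⟨⟨(x, FracGroup.mk p₁ p₂, y), p₁, p₂, rfl, h.symm⟩, ⟨rfl, hU, hV, h.symm⟩, rfl⟩

theorem image_source_arrowBox :
    A.source '' A.arrowBox p₁ p₂ U V = V ∩ A.shift p₂ ⁻¹' (A.shift p₁ '' U) := by
  ext y
  constructor
  · rintro ⟨a, ⟨-, hU, hV, h⟩, rfl⟩
    exact ⟨hV, A.range a, hU, h⟩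
  · rintro ⟨hV, x, hU, h⟩
    exact ⟨⟨(x, FracGroup.mk p₁ p₂, y), p₁, p₂, rfl, h⟩, ⟨rfl, hU, hV, h⟩, rfl⟩

theorem isOpen_image_range_arrowBox (hU : IsOpen U) (hV : IsOpen V) :
    IsOpen (A.range '' A.arrowBox p₁ p₂ U V) := by
  rw [image_range_arrowBox]
  exact hU.inter (((A.isLocalHomeomorph_shift p₂).isOpenMap V hV).preimage (A.continuous_shift p₁))

theorem isOpen_image_source_arrowBox (hU : IsOpen U) (hV : IsOpen V) :
    IsOpen (A.source '' A.arrowBox p₁ p₂ U V) := by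
  rw [image_source_arrowBox]
  exact hV.inter (((A.isLocalHomeomorph_shift p₁).isOpenMap U hU).preimage (A.continuous_shift p₂))

/-- The arrow boxes with sides in `S` on which the two shifts are injective. -/
def injectiveArrowBoxes (S : Set (Set A.H0)) : Set (Set A.H1) :=
  {B | ∃ p₁ p₂, ∃ U ∈ S, ∃ V ∈ S, InjOn (A.shift p₁) U ∧ InjOn (A.shift p₂) V ∧
    A.arrowBox p₁ p₂ U V = B}

theorem countable_injectiveArrowBoxes [Countable P] {S : Set (Set A.H0)} (hS : S.Countable) :
    (A.injectiveArrowBoxes S).Countable := by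
  refine ((countable_univ.prod (hS.prod hS)).image fun j : (P × P) × Set A.H0 × Set A.H0 =>
    A.arrowBox j.1.1 j.1.2 j.2.1 j.2.2).mono ?_
  rintro _ ⟨p₁, p₂, U, hU, V, hV, -, -, rfl⟩
  exact ⟨((p₁, p₂), U, V), ⟨mem_univ _, hU, hV⟩, rfl⟩

theorem exists_arrowBox_subset {B : Set A.H1} (hB : IsOpen B) {a : A.H1} (ha : a ∈ B) :
    ∃ p₁ p₂ U V, IsOpen U ∧ IsOpen V ∧ a ∈ A.arrowBox p₁ p₂ U V ∧ A.arrowBox p₁ p₂ U V ⊆ B := by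
  obtain ⟨⟨x, g, y⟩, p₁, p₂, hg : g = FracGroup.mk p₁ p₂,
    hxy : A.shift p₁ x = A.shift p₂ y⟩ := a
  subst hg
  rw [isOpen_coinduced, isOpen_sigma_iff] at hB
  obtain ⟨O, hO, hOB⟩ := isOpen_induced_iff.1 (hB (p₁, p₂))
  have hmem (z : A.H1Piece p₁ p₂) : z.1 ∈ O ↔ A.fromPieces ⟨(p₁, p₂), z⟩ ∈ B :=
    Set.ext_iff.1 hOB z
  obtain ⟨U, V, hU, hV, hxU, hyV, hUV⟩ := isOpen_prod_iff.1 hO x y ((hmem ⟨(x, y), hxy⟩).2 ha)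
  refine ⟨p₁, p₂, U, V, hU, hV, ⟨rfl, hxU, hyV, hxy⟩, ?_⟩
  rintro ⟨⟨x', g, y'⟩, hg⟩ ⟨h : g = FracGroup.mk p₁ p₂, hx', hy', hxy'⟩
  subst h
  exact (hmem ⟨(x', y'), hxy'⟩).1 (hUV ⟨hx', hy'⟩)

theorem isTopologicalBasis_injectiveArrowBoxes {S : Set (Set A.H0)} (hS : IsTopologicalBasis S) :
    IsTopologicalBasis (A.injectiveArrowBoxes S) := by
  refine isTopologicalBasis_of_isOpen_of_nhds ?_ fun a B ha hB => ?_
  · rintro _ ⟨p₁, p₂, U, hU, V, hV, -, -, rfl⟩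
    exact A.isOpen_arrowBox (hS.isOpen hU) (hS.isOpen hV)
  obtain ⟨p₁, p₂, U, V, hU, hV, ⟨hg, haU, haV, hs⟩, hUV⟩ := A.exists_arrowBox_subset hB ha
  have hside (p : P) {W : Set A.H0} (hW : IsOpen W) {x : A.H0} (hx : x ∈ W) :
      ∃ W' ∈ S, x ∈ W' ∧ W' ⊆ W ∧ InjOn (A.shift p) W' := by
    obtain ⟨W₁, hW₁, hxW₁, hinj⟩ := (A.isLocalHomeomorph_shift p).isLocallyInjective x
    obtain ⟨W', hW', hxW', hsub⟩ := hS.exists_subset_of_mem_open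
      (⟨hx, hxW₁⟩ : x ∈ W ∩ W₁) (hW.inter hW₁)
    exact ⟨W', hW', hxW', hsub.trans inter_subset_left, hinj.mono (hsub.trans inter_subset_right)⟩
  obtain ⟨U', hU', haU', hUU', hinjU⟩ := hside p₁ hU haU
  obtain ⟨V', hV', haV', hVV', hinjV⟩ := hside p₂ hV haV
  exact ⟨_, ⟨p₁, p₂, U', hU', V', hV', hinjU, hinjV, rfl⟩, ⟨hg, haU', haV', hs⟩,
    fun b hb => hUV ⟨hb.1, hUU' hb.2.1, hVV' hb.2.2.1, hb.2.2.2⟩⟩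

theorem exists_seq_injectiveArrowBoxes_iUnion_eq [Countable P] [SecondCountableTopology A.H0]
    {B : Set A.H1} (hB : IsOpen B) (hne : B.Nonempty) :
    ∃ N : ℕ → Set A.H1, (∀ n, N n ∈ A.injectiveArrowBoxes {U | IsOpen U}) ∧ ⋃ n, N n = B := by
  obtain ⟨S, hS, rfl⟩ := (A.isTopologicalBasis_injectiveArrowBoxes
    (isBasis_countableBasis A.H0)).open_eq_sUnion hB
  have hSne : S.Nonempty := (nonempty_sUnion.1 hne).imp fun _ h => h.1
  obtain ⟨N, rfl⟩ := ((A.countable_injectiveArrowBoxes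
    (countable_countableBasis A.H0)).mono hS).exists_eq_range hSne
  refine ⟨N, fun n => ?_, sUnion_range N |>.symm⟩
  obtain ⟨p₁, p₂, U, hU, V, hV, h⟩ := hS (mem_range_self n)
  exact ⟨p₁, p₂, U, isOpen_of_mem_countableBasis hU, V, isOpen_of_mem_countableBasis hV, h⟩

end Bisections

section Invariance

variable [T2Space A.H0] [SecondCountableTopology A.H0] {c : P →* {x : ℝ // 0 < x}}
  {μ : Measure A.H0}

variable {A}

theorem IsInvariantH0.isShiftInvariant [IsLocallyFiniteMeasure μ] (h : A.IsInvariantH0 c μ) :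
    A.IsShiftInvariant c μ := by
  intro p
  have := isLocallyFiniteMeasure_ofReal_smul (c p : ℝ) μ
  rw [← pullback_smul]
  refine eq_pullback_of_isOpen (A.isLocalHomeomorph_shift p) _ fun U hU hinj => ?_
  -- The arrows `(x, p, s̃_p x)` with `x ∈ U` form a bisection with range `U` and source `s̃_p U`.
  have hshift : A.shift 1 = id := funext A.shift_one
  have hB := h _ _ (A.isBisection_arrowBox hU isOpen_univ hinj
    (hshift ▸ injOn_id univ : InjOn (A.shift 1) univ)) fun b hb => hb.1
  rw [image_range_arrowBox, image_source_arrowBox, hshift, image_id, preimage_univ, inter_univ,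
    preimage_id, univ_inter, FracGroup.extend_mk, map_one, div_one] at hB
  rw [hB, Measure.smul_apply, smul_eq_mul]

theorem IsShiftInvariant.measure_eq_mul (hμ : A.IsShiftInvariant c μ) (p : P) {E : Set A.H0}
    (hE : MeasurableSet E) (hinj : InjOn (A.shift p) E) :
    μ E = ENNReal.ofReal (c p) * μ (A.shift p '' E) := by
  conv_lhs => rw [hμ p]
  rw [Measure.smul_apply, pullback_apply_of_injOn (A.isLocalHomeomorph_shift p) μ hE hinj,
    smul_eq_mul]

theorem IsShiftInvariant.measure_image_range (hμ : A.IsShiftInvariant c μ) {p₁ p₂ : P}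
    {U V : Set A.H0} (hU : InjOn (A.shift p₁) U) (hV : InjOn (A.shift p₂) V) {D : Set A.H1}
    (hD : D ⊆ A.arrowBox p₁ p₂ U V) (hr : MeasurableSet (A.range '' D))
    (hs : MeasurableSet (A.source '' D)) :
    μ (A.range '' D) = ENNReal.ofReal (FracGroup.extend c (FracGroup.mk p₁ p₂)) *
      μ (A.source '' D) := by
  have hDU : A.range '' D ⊆ U := image_subset_iff.2 fun a ha => (hD ha).2.1
  have hDV : A.source '' D ⊆ V := image_subset_iff.2 fun a ha => (hD ha).2.2.1
  have hshift : A.shift p₁ '' (A.range '' D) = A.shift p₂ '' (A.source '' D) := by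
    rw [image_image, image_image]
    exact image_congr fun a ha => (hD ha).2.2.2
  rw [hμ.measure_eq_mul p₁ hr (hU.mono hDU), hμ.measure_eq_mul p₂ hs (hV.mono hDV), hshift,
    ← mul_assoc, ← ofReal_val_mul, FracGroup.extend_mk, div_mul_cancel]

theorem IsShiftInvariant.isInvariantH0 [Countable P] (hμ : A.IsShiftInvariant c μ) :
    A.IsInvariantH0 c μ := by
  rintro g B ⟨hB, hrange, hsource⟩ hg
  rcases B.eq_empty_or_nonempty with rfl | hne
  · simp only [image_empty, measure_empty, mul_zero]
  obtain ⟨N, hN, rfl⟩ := A.exists_seq_injectiveArrowBoxes_iUnion_eq hB hne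
  choose p₁ p₂ U hU V hV hinjU hinjV hN using hN
  refine measure_image_iUnion_eq_mul hrange hsource (fun n => ?_) (fun n => ?_) _
    fun n D hD hr hs => ?_
  · exact hN n ▸ (A.isOpen_image_range_arrowBox (hU n) (hV n)).measurableSet
  · exact hN n ▸ (A.isOpen_image_source_arrowBox (hU n) (hV n)).measurableSet
  · rcases D.eq_empty_or_nonempty with rfl | ⟨b, hb⟩
    · simp only [image_empty, measure_empty, mul_zero]
    have hbox : D ⊆ A.arrowBox (p₁ n) (p₂ n) (U n) (V n) := hN n ▸ hD
    rw [← hg b (mem_iUnion.2 ⟨n, hD hb⟩), (hbox hb).1]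
    exact hμ.measure_image_range (hinjU n) (hinjV n) hbox hr hs

variable (A) in
theorem isInvariantH0_iff_isShiftInvariant [Countable P] [IsLocallyFiniteMeasure μ] :
    A.IsInvariantH0 c μ ↔ A.IsShiftInvariant c μ :=
  ⟨IsInvariantH0.isShiftInvariant, IsShiftInvariant.isInvariantH0⟩

end Invariance

end ProperCorrAction

namespace ProperCorrAction

variable {P : Type w} [Monoid P] {X : Type u} [TopologicalSpace X]
  {M : P → Type v} [∀ p, TopologicalSpace (M p)] (A : ProperCorrAction P X M)

section BaseChange

variable [MeasurableSpace X] [BorelSpace X] [∀ p, MeasurableSpace (M p)] [∀ p, BorelSpace (M p)]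

theorem map_r_map_proj (p : P) (μ : Measure A.H0) :
    (μ.map (A.proj p)).map (A.r p) = μ.map A.π₁ := by
  rw [Measure.map_map (A.isProperMap_r p).continuous.measurable (A.continuous_proj p).measurable]
  exact congrArg μ.map (funext (A.r_proj p))

variable [T2Space X] [∀ p, T2Space (M p)] [∀ p, SecondCountableTopology (M p)]
  {c : P →* {x : ℝ // 0 < x}} {ν : Measure X}

variable {A} in
theorem IsInvariantX.map_rr [IsLocallyFiniteMeasure ν] (hν : A.IsInvariantX c ν) {p q t : P}
    (h : p * q = t) :
    (ENNReal.ofReal (c t) • pullback (A.s t) ν).map (A.rr h) =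
      ENNReal.ofReal (c p) • pullback (A.s p) ν := by
  calc (ENNReal.ofReal (c t) • pullback (A.s t) ν).map (A.rr h)
    _ = ENNReal.ofReal (c t) • (pullback (A.ss h) (pullback (A.s q) ν)).map (A.rr h) := by
      rw [pullback_pullback (A.isLocalHomeomorph_ss h) (A.isLocalHomeomorph_s q),
        show A.s q ∘ A.ss h = A.s t from funext (A.s_ss h), Measure.map_smul]
    _ = ENNReal.ofReal (c t) • pullback (A.s p) ((pullback (A.s q) ν).map (A.r q)) := by
      rw [map_pullback_of_bijOn (A.isLocalHomeomorph_s p) (A.isLocalHomeomorph_ss h)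
        (A.continuous_rr h).measurable (A.isProperMap_r q).continuous.measurable (A.bijOn_rr h)]
    _ = ENNReal.ofReal (c p) • pullback (A.s p) ν := by
      conv_rhs => rw [hν q, pullback_smul, smul_smul, ← ofReal_val_mul, ← map_mul, h]

variable [RightOreMonoid P] [SecondCountableTopology A.H0] {μ : Measure A.H0}

variable {A} in
theorem IsShiftInvariant.map_proj (hμ : A.IsShiftInvariant c μ) (p : P) :
    μ.map (A.proj p) = ENNReal.ofReal (c p) • pullback (A.s p) (μ.map A.π₁) := by
  conv_lhs => rw [hμ p]
  rw [Measure.map_smul, map_pullback_of_bijOn (A.isLocalHomeomorph_s p)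
    (A.isLocalHomeomorph_shift p) (A.continuous_proj p).measurable A.continuous_π₁.measurable
    (A.bijOn_proj p)]

theorem map_proj_mul_smul_pullback_shift [IsLocallyFiniteMeasure ν]
    (hμ : ∀ p, μ.map (A.proj p) = ENNReal.ofReal (c p) • pullback (A.s p) ν) (p q : P) :
    (ENNReal.ofReal (c p) • pullback (A.shift p) μ).map (A.proj (p * q)) =
      ENNReal.ofReal (c (p * q)) • pullback (A.s (p * q)) ν := by
  calc (ENNReal.ofReal (c p) • pullback (A.shift p) μ).map (A.proj (p * q))
    _ = ENNReal.ofReal (c p) • pullback (A.ss rfl) (μ.map (A.proj q)) := by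
      rw [Measure.map_smul, map_pullback_of_bijOn (A.isLocalHomeomorph_ss rfl)
        (A.isLocalHomeomorph_shift p) (A.continuous_proj _).measurable
        (A.continuous_proj q).measurable (A.bijOn_proj_mul p q)]
    _ = (ENNReal.ofReal (c p) * ENNReal.ofReal (c q)) •
        pullback (A.ss rfl) (pullback (A.s q) ν) := by rw [hμ q, pullback_smul, smul_smul]
    _ = ENNReal.ofReal (c (p * q)) • pullback (A.s (p * q)) ν := by
      rw [pullback_pullback (A.isLocalHomeomorph_ss rfl) (A.isLocalHomeomorph_s q),
        show A.s q ∘ A.ss rfl = A.s (p * q) from funext (A.s_ss rfl), ← ofReal_val_mul, map_mul]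

variable {A} in
theorem IsShiftInvariant.isInvariantX (hμ : A.IsShiftInvariant c μ) :
    A.IsInvariantX c (μ.map A.π₁) := fun p => by
  rw [← Measure.map_smul, ← hμ.map_proj p, map_r_map_proj]

variable [LocallyCompactSpace X]

variable {A} in
theorem IsShiftInvariant.eq_of_map_π₁_eq {μ' : Measure A.H0} [μ.Regular] [μ'.Regular]
    (hμ : A.IsShiftInvariant c μ) (hμ' : A.IsShiftInvariant c μ')
    (h : μ.map A.π₁ = μ'.map A.π₁) : μ = μ' :=
  A.isProperLimitCone_proj.measure_ext fun p => by rw [hμ.map_proj, hμ'.map_proj, h]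

variable {A} in
theorem IsInvariantX.exists_isShiftInvariant [∀ p, LocallyCompactSpace (M p)] [ν.Regular]
    (hν : A.IsInvariantX c ν) :
    ∃ μ : Measure A.H0, μ.Regular ∧ A.IsShiftInvariant c μ ∧ μ.map A.π₁ = ν := by
  have (p : P) : IsLocallyFiniteMeasure (ENNReal.ofReal (c p) • pullback (A.s p) ν) := by
    have := isLocallyFiniteMeasure_pullback (A.isLocalHomeomorph_s p) ν
    exact isLocallyFiniteMeasure_ofReal_smul _ _
  obtain ⟨μ, hμ, hmap⟩ := A.exists_regular_map_proj_eq
    (ρ := fun p => ENNReal.ofReal (c p) • pullback (A.s p) ν) fun h => hν.map_rr h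
  refine ⟨μ, hμ, fun p => ?_, ?_⟩
  · have := A.locallyCompactSpace_H0
    have := isLocallyFiniteMeasure_pullback (A.isLocalHomeomorph_shift p) μ
    have := isLocallyFiniteMeasure_ofReal_smul (c p) (pullback (A.shift p) μ)
    exact A.measure_ext_of_map_proj_mul p fun q => by
      rw [A.map_proj_mul_smul_pullback_shift hmap, hmap]
  · rw [← A.map_r_map_proj 1, hmap, Measure.map_smul, ← hν 1]

end BaseChange

end ProperCorrAction

end

theorem mainTheorem11 {P : Type w} [Monoid P] [RightOreMonoid P] [Countable P]
    {X : Type u} [TopologicalSpace X] [T2Space X] [LocallyCompactSpace X]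
    [SecondCountableTopology X] [MeasurableSpace X] [BorelSpace X]
    {M : P → Type v} [∀ p, TopologicalSpace (M p)] [∀ p, T2Space (M p)]
    [∀ p, LocallyCompactSpace (M p)] [∀ p, MeasurableSpace (M p)] [∀ p, BorelSpace (M p)]
    (A : ProperCorrAction P X M) (c : P →* {x : ℝ // 0 < x}) :
    Set.BijOn (fun μ : MeasureTheory.Measure A.H0 => μ.map A.π₁)
      {μ | μ.Regular ∧ A.IsInvariantH0 c μ}
      {ν | ν.Regular ∧ A.IsInvariantX c ν} := by
  have := A.secondCountable_M
  have := A.secondCountableTopology_H0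
  have := A.locallyCompactSpace_H0
  refine ⟨?_, ?_, ?_⟩
  · rintro μ ⟨hμ, hinv⟩
    rw [A.isInvariantH0_iff_isShiftInvariant] at hinv
    exact ⟨regular_map_of_isProperMap A.isProperMap_π₁ μ, hinv.isInvariantX⟩
  · rintro μ ⟨hμ, hinv⟩ μ' ⟨hμ', hinv'⟩ h
    rw [A.isInvariantH0_iff_isShiftInvariant] at hinv hinv'
    exact hinv.eq_of_map_π₁_eq hinv' h
  · rintro ν ⟨hν, hinv⟩
    obtain ⟨μ, hμ, hshift, hmap⟩ := hinv.exists_isShiftInvariant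
    exact ⟨μ, ⟨hμ, A.isInvariantH0_iff_isShiftInvariant.2 hshift⟩, hmap⟩
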